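/- Let $\mathbf T^4=(\mathbf R/2\pi\mathbf Z)^4$, let $G$ be the Green's function of $1-\Delta$ on $\mathbf T^4$, and for $\varepsilon\in(0,1)$ let $G_\varepsilon=\varrho_\varepsilon\star G$ with $\varrho_\varepsilon(x)=\varepsilon^{-4}\varrho(x/\varepsilon)$, where $\varrho\ge 0$ is a radial, smooth, compactly supported function on $\mathbf R^4$ with $\int\varrho=1$. For $\hat\lambda\in\mathbf R$ set $\lambda_\varepsilon=\hat\lambda\,(\log\tfrac1\varepsilon)^{-1/2}$. Let $\mathcal I_n$ ($n\ge1$) be the directed path with $n$ internal vertices between a bottom leaf and a top leaf, with $n+1$ edges pointing upwards. For $k\ge1$, $n_1,\dots,n_k\ge1$ and a complete pairing $\kappa$ of all the internal vertices of $\mathcal I_{n_1},\dots,\mathcal I_{n_k}$ (a fixed-point-free involution), let $\Gamma=(\mathcal I_{n_1},\dots,\mathcal I_{n_k})_\kappa$ be the directed multigraph obtained by identifying paired vertices; it is called a $2k$-Anderson–Feynman diagram. Let $L$ be the set of its $2k$ leaves, $V_\star$ the set of its other (internal) vertices, $E$ the multiset of its edges and $E_\star$ that of the internal edges, i.e. those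 between internal vertices. For $\varphi\in C^\infty((\mathbf T^4)^L;\mathbf R)$ set $$\Pi_\varepsilon\Gamma(x_L)=\int_{(\mathbf T^4)^{V_\star}}\prod_{e\in E}G_\varepsilon(x_{e_+}-x_{e_-})\,\mathrm dx_{V_\star},\qquad \Pi_\varepsilon\Gamma(\varphi)=\int_{(\mathbf T^4)^L}\Pi_\varepsilon\Gamma(x_L)\,\varphi(x_L)\,\mathrm dx_L .$$ A subdiagram $\bar\Gamma=(\bar V,\bar E)$ of $\Gamma$ consists of a set of internal vertices and a sub-multiset of the internal edges between them. Its degree is the sum over its connected components of $4(|\bar V|-1)-2|\bar E|$. It is full if it contains all parallel copies of each of its edges. $\Gamma$ is positive if every subdiagram with at least one edge has degree $>0$; it has zero degree if every subdiagram has degree $\ge0$ and some subdiagram with at least one edge has degree $0$. $\Gamma$ is a nested bubble diagram if, by successively contracting full bubbles (two distinct internal vertices joined by exactly two, parallel or opposite, edges) to single vertices and deleting the two edges, it can be reduced to the diagram with one internal vertex, four legs and no internal edges. Let further $\hat\Pi_\varepsilon\Gamma=\sum_{\mathfrak F}(-1)^{|\mathfrak F|}\,\Pi_\varepsilon\mathcal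 C_{\mathfrak F}\Gamma$ be the BPHZ-renormalised valuation. The sum runs over all forests $\mathfrak F$, i.e. sets of connected full subdiagrams of negative degree, any two of which are nested or vertex-disjoint. $\mathcal C_{\mathfrak F}\Gamma$ is the product of $\Gamma$, with the maximal elements of $\mathfrak F$ contracted to points, and of all $\gamma\in\mathfrak F$, with the maximal elements of $\mathfrak F$ strictly inside $\gamma$ contracted to points. $\Pi_\varepsilon$ is multiplicative, and connected diagrams without leaves are integrated over all variables but one. 1. For all $k,m$ and every $\varepsilon_0\in(0,1)$ there is a constant $C$ (depending only on $k$, $m$, $\varepsilon_0$ and $\varrho$) such that for every connected $2k$-Anderson–Feynman diagram $\Gamma$ with $|E_\star|=m$ that is positive or has zero degree, every $\varphi$ and every $\hat\lambda\in\mathbf R$, $$\sup_{\varepsilon\in(0,\varepsilon_0]}|\lambda_\varepsilon|^{|E_\star|}\,|\Pi_\varepsilon\Gamma(\varphi)|\le C\,\|\varphi\|_\infty\,|\hat\lambda|^{|E_\star|}.$$ 2. If $\Gamma$ is a connected $2k$-Anderson–Feynman diagram that is positive or has zero degree, and if $k\ne2$ or $\Gamma$ is not a nested bubble diagram, then $\lim_{\varepsilon\to0}|\lambda_\varepsilon|^{|E_\star|}\,|\Pi_\varepsilon\Gamma(\varphi)|=0$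 for all $\varphi$ and $\hat\lambda$. 3. If $\Gamma=(\mathcal I_{n_1},\dots,\mathcal I_{n_k})_\kappa$ is positive (connected or not), then $\hat\Pi_\varepsilon\Gamma=\Pi_\varepsilon\Gamma$ for all $\varepsilon\in(0,1)$, and $\sup_{\varepsilon\in(0,1)}|\Pi_\varepsilon\Gamma(\varphi)|<\infty$ for every $\varphi$. If moreover $\Gamma$ has at least one internal edge (i.e. some $n_i\ge2$), then $\Gamma$ does not contribute: $\lim_{\varepsilon\to0}\lambda_\varepsilon^{\sum_i(n_i-1)}\,\hat\Pi_\varepsilon\Gamma(\varphi)=0$ for all $\varphi$ and $\hat\lambda$. -/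

import Mathlib

open scoped Topology

noncomputable section

namespace AndersonFeynman

/-! ### The torus, the Green's function and the weak coupling constant -/

instance two_pi_pos_fact : Fact (0 < 2 * Real.pi) := ⟨Real.two_pi_pos⟩

/-- The torus `𝐓⁴ = (ℝ / 2πℤ)⁴`; its `volume` is Lebesgue measure, of total mass `(2π)⁴`. -/
abbrev Torus : Type := Fin 4 → AddCircle (2 * Real.pi)

/-- The projection `ℝ⁴ → 𝐓⁴`. -/
def toTorus (y : EuclideanSpace ℝ (Fin 4)) : Torus := fun i => (y i : AddCircle (2 * Real.pi))

/-- The heat kernel of `∂ₜ - Δ` on `ℝ⁴`. -/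
def heatKernel (t : ℝ) (y : EuclideanSpace ℝ (Fin 4)) : ℝ :=
  1 / (4 * Real.pi * t) ^ 2 * Real.exp (-(‖y‖ ^ 2) / (4 * t))

/-- The heat kernel on `𝐓⁴`: the periodisation of the one on `ℝ⁴`,
i.e. the sum over all representatives of the point `x`. -/
def torusHeatKernel (t : ℝ) (x : Torus) : ℝ :=
  ∑' y : {y : EuclideanSpace ℝ (Fin 4) // toTorus y = x}, heatKernel t y

/-- The Green's function of `1 - Δ` on `𝐓⁴`, i.e. the kernel of
`(1 - Δ)⁻¹ = ∫₀^∞ e^{-t} e^{tΔ} dt`. It is finite and positive off the origin. -/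
def green (x : Torus) : ℝ :=
  ∫ t in Set.Ioi (0 : ℝ), Real.exp (-t) * torusHeatKernel t x

/-- The admissible mollifiers: smooth, compactly supported, nonnegative, radial, of mass one. -/
structure IsMollifier (ρ : EuclideanSpace ℝ (Fin 4) → ℝ) : Prop where
  smooth : ContDiff ℝ (⊤ : ℕ∞) ρ
  compact_support : HasCompactSupport ρ
  nonneg : ∀ y, 0 ≤ ρ y
  radial : ∀ y z, ‖y‖ = ‖z‖ → ρ y = ρ z
  mass_one : ∫ y, ρ y = 1

/-- The mollified Green's function `G_ε = ρ_ε ⋆ G`, where `ρ_ε(y) = ε⁻⁴ ρ(y / ε)`. -/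
def greenMoll (ρ : EuclideanSpace ℝ (Fin 4) → ℝ) (ε : ℝ) (x : Torus) : ℝ :=
  ∫ y : EuclideanSpace ℝ (Fin 4), (ε ^ 4)⁻¹ * ρ (ε⁻¹ • y) * green (x - toTorus y)

/-- The coupling constant `λ_ε = λ̂ (log (1/ε))^{-1/2}`. -/
def coupling (lam ε : ℝ) : ℝ := lam * Real.log (1 / ε) ^ (-(1 / 2) : ℝ)

/-- `φ` belongs to `C^∞((𝐓⁴)^L; ℝ)`: its `2π`-periodic lift to `(ℝ⁴)^L` is smooth. -/
def IsSmooth {L : Type} [Fintype L] (φ : (L → Torus) → ℝ) : Prop :=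
  ContDiff ℝ (⊤ : ℕ∞)
    (fun y : L → Fin 4 → ℝ => φ fun l i => (y l i : AddCircle (2 * Real.pi)))

/-! ### Feynman diagrams -/

/-- A Feynman diagram: a finite directed multigraph with vertex set `I ⊕ L`, where `I` are the
internal vertices (`V⋆`) and `L` the leaves. Edges are labelled by `E`, so that two different
labels with the same endpoints are parallel edges. -/
structure FeynmanDiagram : Type 1 where
  I : Type
  L : Type
  E : Type
  [fintypeI : Fintype I]
  [fintypeL : Fintype L]
  [fintypeE : Fintype E]
  src : E → I ⊕ L
  tgt : E → I ⊕ L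

namespace FeynmanDiagram

attribute [instance] fintypeI fintypeL fintypeE

variable (Γ : FeynmanDiagram)

/-- The internal edges `E⋆`, i.e. those with both endpoints internal. -/
def intEdges : Set Γ.E :=
  {e | (∃ v, Γ.src e = Sum.inl v) ∧ ∃ w, Γ.tgt e = Sum.inl w}

/-- The number `|E⋆|` of internal edges. -/
def numIntEdges : ℕ := Γ.intEdges.ncard

/-- The underlying simple undirected graph, which determines the connected components. -/
def graph : SimpleGraph (Γ.I ⊕ Γ.L) :=
  SimpleGraph.fromRel fun a b => ∃ e, Γ.src e = a ∧ Γ.tgt e = b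

/-- Connected (in particular non-empty) diagrams. -/
def Connected : Prop := Γ.graph.Connected

/-! ### Valuation -/

/-- In a connected component without leaves the variable of one (arbitrary) vertex is not
integrated over. `Γ.Pinned v` says that `v` is this vertex in its component. -/
def Pinned (v : Γ.I) : Prop :=
  (∀ l, ¬ Γ.graph.Reachable (Sum.inl v) (Sum.inr l)) ∧
    Quot.out (Γ.graph.connectedComponentMk (Sum.inl v)) = Sum.inl v

/-- The vertices whose variables are integrated over; all of `V⋆` if every component of the
diagram has a leaf. -/
abbrev Free : Type := {v : Γ.I // ¬ Γ.Pinned v}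

open Classical in
instance fintypeFree : Fintype Γ.Free := Fintype.ofFinite _

open Classical in
/-- The variable attached to a vertex, given the integration variables `y` and the leaf variables
`x`; pinned vertices sit at `0` (the position is irrelevant, by translation invariance). -/
def position (y : Γ.Free → Torus) (x : Γ.L → Torus) : Γ.I ⊕ Γ.L → Torus
  | Sum.inl v => if h : Γ.Pinned v then 0 else y ⟨v, h⟩
  | Sum.inr l => x l

/-- The valuation `Π_ε Γ (x_L) = ∫ ∏_e G_ε(x_{e₊} - x_{e₋}) dx`, where the product runs over all
edges, internal ones and legs. For disconnected diagrams this single integral is the product of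
the valuations of the connected components, since the integrand factorises. -/
def val (ρ : EuclideanSpace ℝ (Fin 4) → ℝ) (ε : ℝ) (x : Γ.L → Torus) : ℝ :=
  ∫ y : Γ.Free → Torus,
    ∏ e : Γ.E, greenMoll ρ ε (Γ.position y x (Γ.tgt e) - Γ.position y x (Γ.src e))

/-- The tested valuation `Π_ε Γ (φ)`. -/
def valTest (ρ : EuclideanSpace ℝ (Fin 4) → ℝ) (ε : ℝ) (φ : (Γ.L → Torus) → ℝ) : ℝ :=
  ∫ x : Γ.L → Torus, Γ.val ρ ε x * φ x

/-! ### Subdiagrams, degree -/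

/-- A subdiagram: a set of internal vertices and a set of internal edges between them. -/
@[ext]
structure Subdiagram where
  verts : Set Γ.I
  edges : Set Γ.E
  src_mem : ∀ e ∈ edges, ∃ v ∈ verts, Γ.src e = Sum.inl v
  tgt_mem : ∀ e ∈ edges, ∃ v ∈ verts, Γ.tgt e = Sum.inl v

variable {Γ}

namespace Subdiagram

theorem toProd_injective :
    Function.Injective fun γ : Γ.Subdiagram => (γ.verts, γ.edges) := by
  intro γ δ h
  have h' := Prod.mk.inj h
  exact Subdiagram.ext h'.1 h'.2

/-- Inclusion of subdiagrams: inclusion of vertices and of edges. -/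
instance partialOrder : PartialOrder Γ.Subdiagram :=
  PartialOrder.lift _ toProd_injective

instance finite : Finite Γ.Subdiagram := Finite.of_injective _ toProd_injective

open Classical in
instance fintype : Fintype Γ.Subdiagram := Fintype.ofFinite _

open Classical in
/-- A subdiagram, seen as a Feynman diagram without leaves. -/
def toDiagram (γ : Γ.Subdiagram) : FeynmanDiagram where
  I := {v : Γ.I // v ∈ γ.verts}
  L := Empty
  E := {e : Γ.E // e ∈ γ.edges}
  fintypeI := Fintype.ofFinite _
  fintypeE := Fintype.ofFinite _
  src e := Sum.inl ⟨(γ.src_mem e.1 e.2).choose, (γ.src_mem e.1 e.2).choose_spec.1⟩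
  tgt e := Sum.inl ⟨(γ.tgt_mem e.1 e.2).choose, (γ.tgt_mem e.1 e.2).choose_spec.1⟩

/-- Connected (in particular non-empty) subdiagrams. -/
def Connected (γ : Γ.Subdiagram) : Prop := γ.toDiagram.Connected

/-- Full subdiagrams: with an edge `e = (e₋, e₊)` they contain all its parallel copies. -/
def Full (γ : Γ.Subdiagram) : Prop :=
  ∀ e ∈ γ.edges, ∀ e', Γ.src e' = Γ.src e → Γ.tgt e' = Γ.tgt e → e' ∈ γ.edges

/-- The degree: the sum over the connected components of `4 (|V| - 1) - 2 |E|`. -/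
def degree (γ : Γ.Subdiagram) : ℤ :=
  4 * ((γ.verts.ncard : ℤ) - (Nat.card γ.toDiagram.graph.ConnectedComponent : ℤ))
    - 2 * (γ.edges.ncard : ℤ)

/-- The bubble: two distinct vertices joined by two edges, which are either parallel or
opposite. -/
def IsBubble (γ : Γ.Subdiagram) : Prop :=
  ∃ v w : Γ.I, v ≠ w ∧ γ.verts = {v, w} ∧ γ.edges.ncard = 2 ∧
    ∀ e ∈ γ.edges, (Γ.src e = Sum.inl v ∧ Γ.tgt e = Sum.inl w) ∨
      (Γ.src e = Sum.inl w ∧ Γ.tgt e = Sum.inl v)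

/-- The part of `δ` inside `γ`, as a subdiagram of the diagram `γ`
(this is `δ` itself when `δ ≤ γ`). -/
def restrict (γ δ : Γ.Subdiagram) : γ.toDiagram.Subdiagram where
  verts := {v | v.1 ∈ δ.verts}
  edges := {e | e.1 ∈ δ.edges}
  src_mem := by
    intro e he
    obtain ⟨v, hv, hve⟩ := δ.src_mem e.1 he
    refine ⟨_, ?_, rfl⟩
    have h : (γ.src_mem e.1 e.2).choose = v :=
      Sum.inl.inj ((γ.src_mem e.1 e.2).choose_spec.2.symm.trans hve)
    have h' : (γ.src_mem e.1 e.2).choose ∈ δ.verts := h.symm ▸ hv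
    exact h'
  tgt_mem := by
    intro e he
    obtain ⟨v, hv, hve⟩ := δ.tgt_mem e.1 he
    refine ⟨_, ?_, rfl⟩
    have h : (γ.tgt_mem e.1 e.2).choose = v :=
      Sum.inl.inj ((γ.tgt_mem e.1 e.2).choose_spec.2.symm.trans hve)
    have h' : (γ.tgt_mem e.1 e.2).choose ∈ δ.verts := h.symm ▸ hv
    exact h'

end Subdiagram

variable (Γ)

/-- Positive diagrams. Subdiagrams without edges always have degree zero and are disregarded. -/
def IsPositive : Prop :=
  ∀ γ : Γ.Subdiagram, γ.edges.Nonempty → 0 < γ.degree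

/-- Zero degree diagrams. Again subdiagrams without edges are disregarded. -/
def IsZeroDegree : Prop :=
  (∀ γ : Γ.Subdiagram, 0 ≤ γ.degree) ∧ ∃ γ : Γ.Subdiagram, γ.edges.Nonempty ∧ γ.degree = 0

/-! ### Contractions and nested bubble diagrams -/

open Classical in
/-- The diagram obtained by contracting each member of a family of (connected, vertex-disjoint)
subdiagrams to a vertex of its own and deleting their edges. -/
def contract (S : Set Γ.Subdiagram) : FeynmanDiagram where
  I := Quot fun v w : Γ.I => ∃ γ ∈ S, v ∈ γ.verts ∧ w ∈ γ.verts
  L := Γ.L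
  E := {e : Γ.E // ∀ γ ∈ S, e ∉ γ.edges}
  fintypeI := Fintype.ofFinite _
  fintypeE := Fintype.ofFinite _
  src e := Sum.map (Quot.mk _) id (Γ.src e.1)
  tgt e := Sum.map (Quot.mk _) id (Γ.tgt e.1)

/-- The diagram with a single internal vertex, no internal edges and four legs, each of which
joins a leaf of its own to that vertex. -/
def IsCross : Prop :=
  Nat.card Γ.I = 1 ∧ Nat.card Γ.L = 4 ∧ Γ.intEdges = ∅ ∧
    (∀ e, (∃ l v, Γ.src e = Sum.inr l ∧ Γ.tgt e = Sum.inl v) ∨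
      (∃ v l, Γ.src e = Sum.inl v ∧ Γ.tgt e = Sum.inr l)) ∧
    ∀ l, ∃! e, Γ.src e = Sum.inr l ∨ Γ.tgt e = Sum.inr l

/-- Nested bubble diagrams: those that become a cross after successive contractions of (full)
bubbles. Each contraction removes one internal vertex, so that a diagram with `n` internal
vertices takes exactly `n - 1` of them. -/
inductive IsNestedBubble : FeynmanDiagram → Prop
  | cross (Γ : FeynmanDiagram) (h : Γ.IsCross) : IsNestedBubble Γ
  | bubble (Γ : FeynmanDiagram) (γ : Γ.Subdiagram) (hγ : γ.IsBubble) (hfull : γ.Full)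
      (h : IsNestedBubble (Γ.contract {γ})) : IsNestedBubble Γ

/-! ### BPHZ renormalisation -/

/-- The divergent subdiagrams `𝒢⁻_Γ`. -/
def divergent : Set Γ.Subdiagram :=
  {γ | γ.Connected ∧ γ.Full ∧ γ.degree < 0}

open Classical in
/-- The forests `ℱ⁻_Γ`: sets of divergent subdiagrams, any two of which are either nested or
vertex-disjoint. -/
def forests : Finset (Finset Γ.Subdiagram) :=
  Finset.univ.filter fun F => (∀ γ ∈ F, γ ∈ Γ.divergent) ∧
    ∀ γ ∈ F, ∀ δ ∈ F, γ ≤ δ ∨ δ ≤ γ ∨ Disjoint γ.verts δ.verts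

variable {Γ}

/-- The maximal elements of a forest. -/
def roots (F : Finset Γ.Subdiagram) : Set Γ.Subdiagram :=
  {γ | Maximal (fun δ => δ ∈ F) γ}

/-- The maximal elements of a forest among those strictly contained in `γ`. -/
def children (F : Finset Γ.Subdiagram) (γ : Γ.Subdiagram) : Set Γ.Subdiagram :=
  {δ | Maximal (fun δ' => δ' ∈ F ∧ δ' < γ) δ}

variable (Γ)

/-- `Π_ε` applied to the extraction `𝒞_F Γ = Γ / roots(F) · ∏_{γ ∈ F} γ / children(γ)`. -/
def valExtract (ρ : EuclideanSpace ℝ (Fin 4) → ℝ) (ε : ℝ) (F : Finset Γ.Subdiagram)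
    (x : Γ.L → Torus) : ℝ :=
  (Γ.contract (roots F)).val ρ ε x *
    ∏ γ ∈ F, (γ.toDiagram.contract (γ.restrict '' children F γ)).val ρ ε (fun l => nomatch l)

/-- The BPHZ renormalised valuation, given by Zimmermann's forest formula
`∑_F (-1)^{|F|} Π_ε 𝒞_F Γ`. -/
def renVal (ρ : EuclideanSpace ℝ (Fin 4) → ℝ) (ε : ℝ) (x : Γ.L → Torus) : ℝ :=
  ∑ F ∈ Γ.forests, (-1) ^ F.card * Γ.valExtract ρ ε F x

/-- The tested renormalised valuation. -/
def renValTest (ρ : EuclideanSpace ℝ (Fin 4) → ℝ) (ε : ℝ) (φ : (Γ.L → Torus) → ℝ) : ℝ :=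
  ∫ x : Γ.L → Torus, Γ.renVal ρ ε x * φ x

end FeynmanDiagram

/-! ### Anderson–Feynman diagrams -/

/-- A complete pairing of the internal vertices of the linear trees `ℐ_{n₁}, …, ℐ_{n_k}`, where
`⟨i, j⟩` is the `(j+1)`-st internal vertex, from the bottom, of the `i`-th tree. -/
structure Pairing {k : ℕ} (n : Fin k → ℕ) where
  toFun : (Σ i, Fin (n i)) → (Σ i, Fin (n i))
  involutive : ∀ a, toFun (toFun a) = a
  no_fixed : ∀ a, toFun a ≠ a

open Classical in
/-- The `2k`-Anderson–Feynman diagram `(ℐ_{n₁}, …, ℐ_{n_k})_κ`. The tree `ℐ_n` is the directed path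
with `n` internal vertices between a bottom leaf and a top leaf; its `n + 1` edges point upwards.
Here `(i, false)` and `(i, true)` are the bottom and the top leaf of the `i`-th tree, `⟨i, j⟩` is
its edge number `j` from the bottom, and vertices paired by `κ` are identified. -/
def paired {k : ℕ} (n : Fin k → ℕ) (κ : Pairing n) : FeynmanDiagram where
  I := Quot fun a b : (Σ i, Fin (n i)) => b = κ.toFun a
  L := Fin k × Bool
  E := Σ i, Fin (n i + 1)
  fintypeI := Fintype.ofFinite _
  src e := Fin.cases (motive := fun _ => _) (Sum.inr (e.1, false))
    (fun j => Sum.inl (Quot.mk _ ⟨e.1, j⟩)) e.2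
  tgt e := Fin.lastCases (motive := fun _ => _) (Sum.inr (e.1, true))
    (fun j => Sum.inl (Quot.mk _ ⟨e.1, j⟩)) e.2

end AndersonFeynman

end

/-!
The mollified Green's function is bounded by `A (‖x‖ + ε)⁻²`. For a given configuration of the
internal vertices run Kruskal's algorithm: successively merge the two closest clusters, through a
pair of vertices at difference `zᵢ`. An edge is at least as long as the merge that first puts its
endpoints into one cluster, so the integrand is dominated by a product of powers of `‖zᵢ‖ + ε` with
`‖z₀‖ ≤ ‖z₁‖ ≤ …`. The subdiagram formed by the clusters after `i` merges, with `mᵢ` edges inside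
them, has degree at most `4 i - 2 mᵢ`. If all degrees are nonnegative, integrating out
`z₀, z₁, …` in turn never diverges worse than logarithmically, and it produces one factor
`1 + log (1 / ε)` for every `i ≥ 1` with `mᵢ = 2 i`.

Such `i` number at most `m / 2`, where `m` is the number of internal edges, so the factor
`(log (1 / ε))^(-m / 2)` from the couplings compensates the logarithms. For a connected diagram
with internal vertices of valence four, equality forces `mᵢ = 2 i` for every `i`: each merge
contracts a full bubble, and the diagram is a nested bubble diagram with four leaves. In a positive
diagram no logarithm occurs and there is nothing to renormalise.
-/

namespace AndersonFeynman

open MeasureTheory Set Module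
open scoped ENNReal NNReal

theorem lintegral_fun_norm_eq {E : Type*} [NormedAddCommGroup E] [NormedSpace ℝ E]
    [MeasurableSpace E] [BorelSpace E] [FiniteDimensional ℝ E] [Nontrivial E] (μ : Measure E)
    [μ.IsAddHaarMeasure] {f : ℝ → ℝ≥0∞} (hf : Measurable f) :
    ∫⁻ x, f ‖x‖ ∂μ = finrank ℝ E * μ (Metric.ball 0 1) *
      ∫⁻ s in Ioi (0 : ℝ), ENNReal.ofReal (s ^ (finrank ℝ E - 1)) * f s := by
  calc ∫⁻ x, f ‖x‖ ∂μ
      = ∫⁻ x : ({0}ᶜ : Set E), f ‖x.1‖ ∂(μ.comap (↑)) := by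
        rw [lintegral_subtype_comap (measurableSet_singleton _).compl fun x ↦ f ‖x‖,
          restrict_compl_singleton]
    _ = ∫⁻ x, f x.2 ∂μ.toSphere.prod (Measure.volumeIoiPow (finrank ℝ E - 1)) := by
        simpa using μ.measurePreserving_homeomorphUnitSphereProd.lintegral_comp
          (f := f ∘ Subtype.val ∘ Prod.snd) (by fun_prop)
    _ = (∫⁻ s : Ioi (0 : ℝ), f s ∂Measure.volumeIoiPow (finrank ℝ E - 1)) * μ.toSphere univ := by
        rw [lintegral_prod _ (by fun_prop)]
        simp only [lintegral_const]
    _ = _ := by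
        rw [Measure.volumeIoiPow, lintegral_withDensity_eq_lintegral_mul _ (by fun_prop)
          (by fun_prop), μ.toSphere_apply_univ, mul_comm]
        congr 1
        exact lintegral_subtype_comap measurableSet_Ioi
          fun s : ℝ ↦ ENNReal.ofReal (s ^ (finrank ℝ E - 1)) * f s

theorem norm_torus_le_pi (z : Torus) : ‖z‖ ≤ Real.pi := by
  refine (pi_norm_le_iff_of_nonneg Real.pi_pos.le).2 fun i ↦ ?_
  refine (AddCircle.norm_le_half_period _ Real.two_pi_pos.ne').trans_eq ?_
  rw [abs_of_pos Real.two_pi_pos, mul_div_cancel_left₀ _ two_ne_zero]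

theorem norm_coe_torus {u : Fin 4 → ℝ} (hu : ∀ i, |u i| ≤ Real.pi) :
    ‖fun i ↦ (u i : AddCircle (2 * Real.pi))‖ = ‖u‖ := by
  have hcoe : ∀ i, ‖(u i : AddCircle (2 * Real.pi))‖₊ = ‖u i‖₊ := fun i ↦ NNReal.eq <|
    (AddCircle.norm_coe_eq_abs_iff _ Real.two_pi_pos.ne').2 <| by
      rw [abs_of_pos Real.two_pi_pos, mul_div_cancel_left₀ _ two_ne_zero]
      exact hu i
  simp only [Pi.norm_def, hcoe]

theorem lintegral_torus_fun_norm_le {f : ℝ → ℝ≥0∞} (hf : Measurable f) :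
    ∫⁻ z : Torus, f ‖z‖ ≤ 64 * ∫⁻ s in Ioi (0 : ℝ), ENNReal.ofReal (s ^ 3) * f s := by
  let box : Set (Fin 4 → ℝ) := univ.pi fun _ ↦ Ioc (-Real.pi) (-Real.pi + 2 * Real.pi)
  have hmk : MeasurePreserving (fun (u : Fin 4 → ℝ) i ↦ (u i : AddCircle (2 * Real.pi)))
      (volume.restrict box) := by
    rw [volume_pi, Measure.restrict_pi_pi]
    exact measurePreserving_pi _ _ fun _ ↦ AddCircle.measurePreserving_mk _ _
  have hnorm : ∀ u ∈ box, ‖fun i ↦ (u i : AddCircle (2 * Real.pi))‖ = ‖u‖ := fun u hu ↦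
    norm_coe_torus fun i ↦ abs_le.2 ⟨(hu i trivial).1.le, by linarith [(hu i trivial).2]⟩
  calc ∫⁻ z : Torus, f ‖z‖
      = ∫⁻ u in box, f ‖fun i ↦ (u i : AddCircle (2 * Real.pi))‖ :=
        (hmk.lintegral_comp (hf.comp measurable_norm)).symm
    _ = ∫⁻ u in box, f ‖u‖ := setLIntegral_congr_fun
        (MeasurableSet.univ_pi fun _ ↦ measurableSet_Ioc) fun u hu ↦ by simp only [hnorm u hu]
    _ ≤ ∫⁻ u : Fin 4 → ℝ, f ‖u‖ := setLIntegral_le_lintegral _ _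
    _ = _ := by
        rw [lintegral_fun_norm_eq _ hf, Real.volume_pi_ball _ one_pos]
        norm_num


/-- The bound `(‖z‖ + ε)⁻²` satisfied, up to a constant, by the mollified Green's function. -/
noncomputable def decay (ε : ℝ) (z : Torus) : ℝ≥0∞ := (ENNReal.ofReal (‖z‖ + ε) ^ 2)⁻¹

@[fun_prop]
theorem measurable_decay (ε : ℝ) : Measurable (decay ε) := by
  unfold decay
  fun_prop

/-- The factor lost when integrating over a scale of degree zero. -/
noncomputable def logFactor (ε : ℝ) : ℝ≥0∞ := ENNReal.ofReal (1 + Real.log (1 / ε))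

theorem one_le_logFactor {ε : ℝ} (hε : 0 < ε) (hε1 : ε < 1) : 1 ≤ logFactor ε := by
  have : 0 ≤ Real.log (1 / ε) := Real.log_nonneg (one_le_one_div hε hε1.le)
  simpa [logFactor] using this

theorem lintegral_Ioc_inv_add_le {ε r : ℝ} (hε : 0 < ε) (hε1 : ε < 1) (hr : 0 ≤ r)
    (hr4 : r ≤ 4) :
    ∫⁻ s in Ioc 0 r, (ENNReal.ofReal (s + ε))⁻¹ ≤ 2 * logFactor ε := by
  have hint : IntervalIntegrable (fun s ↦ (s + ε)⁻¹) volume 0 r :=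
    ContinuousOn.intervalIntegrable_of_Icc hr <|
      ContinuousOn.inv₀ (by fun_prop) fun s hs ↦ by linarith [hs.1]
  have hlog : Real.log ((r + ε) / ε) ≤ 2 * (1 + Real.log (1 / ε)) := by
    have h5 : Real.log (r + ε) ≤ 2 := by
      rw [Real.log_le_iff_le_exp (by linarith)]
      have := Real.quadratic_le_exp_of_nonneg zero_le_two
      linarith
    have hε' : 0 ≤ Real.log (1 / ε) := Real.log_nonneg (one_le_one_div hε hε1.le)
    rw [Real.log_div (by linarith) hε.ne']
    rw [one_div, Real.log_inv] at hε' ⊢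
    linarith
  calc ∫⁻ s in Ioc 0 r, (ENNReal.ofReal (s + ε))⁻¹
      = ∫⁻ s in Ioc 0 r, ENNReal.ofReal (s + ε)⁻¹ :=
        setLIntegral_congr_fun measurableSet_Ioc fun s hs ↦
          (ENNReal.ofReal_inv_of_pos (by linarith [hs.1])).symm
    _ = ENNReal.ofReal (∫ s in (0)..r, (s + ε)⁻¹) := by
        rw [intervalIntegral.integral_of_le hr, ofReal_integral_eq_lintegral_ofReal hint.1]
        filter_upwards [ae_restrict_mem measurableSet_Ioc] with s hs
        exact inv_nonneg.2 (by linarith [hs.1])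
    _ = ENNReal.ofReal (Real.log ((r + ε) / ε)) := by
        rw [intervalIntegral.integral_comp_add_right (fun s ↦ s⁻¹),
          integral_inv_of_pos (by linarith) (by linarith), zero_add]
    _ ≤ 2 * logFactor ε := by
        rw [logFactor, ← ENNReal.ofReal_ofNat, ← ENNReal.ofReal_mul zero_le_two]
        exact ENNReal.ofReal_le_ofReal hlog

theorem lintegral_Ioc_pow_mul_inv_add_le {ε r : ℝ} (hε : 0 < ε) (hε1 : ε < 1) (hr : 0 ≤ r)
    (hr4 : r ≤ 4) (S : ℕ) :
    ∫⁻ s in Ioc 0 r, (ENNReal.ofReal (s + ε))⁻¹ * ENNReal.ofReal (s + ε) ^ S ≤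
      2 * (if S = 0 then logFactor ε else 1) * ENNReal.ofReal (r + ε) ^ S := by
  rcases S with _ | S
  · simpa using lintegral_Ioc_inv_add_le hε hε1 hr hr4
  calc ∫⁻ s in Ioc 0 r, (ENNReal.ofReal (s + ε))⁻¹ * ENNReal.ofReal (s + ε) ^ (S + 1)
      ≤ ∫⁻ _ in Ioc 0 r, ENNReal.ofReal (r + ε) ^ S := by
        refine setLIntegral_mono measurable_const fun s hs ↦ ?_
        rw [pow_succ', ← mul_assoc, ENNReal.inv_mul_cancel
          (by simpa using add_pos hs.1 hε) ENNReal.ofReal_ne_top, one_mul]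
        gcongr
        exact hs.2
    _ ≤ ENNReal.ofReal (r + ε) ^ (S + 1) := by
        rw [setLIntegral_const, Real.volume_Ioc, sub_zero, pow_succ]
        gcongr
        linarith
    _ ≤ _ := by
        rw [if_neg S.succ_ne_zero, mul_one]
        exact le_mul_of_one_le_left' one_le_two

theorem setLIntegral_decay_sq_mul_le {ε r : ℝ} (hε : 0 < ε) (hε1 : ε < 1) (hr : 0 ≤ r)
    (hr4 : r ≤ 4) (S : ℕ) :
    ∫⁻ z in Metric.closedBall 0 r, decay ε z ^ 2 * ENNReal.ofReal (‖z‖ + ε) ^ S ≤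
      128 * (if S = 0 then logFactor ε else 1) * ENNReal.ofReal (r + ε) ^ S := by
  let w (s : ℝ) : ℝ≥0∞ := ENNReal.ofReal (s + ε)
  let f : ℝ → ℝ≥0∞ := (Iic r).indicator fun s ↦ ((w s ^ 2)⁻¹) ^ 2 * w s ^ S
  have hf : Measurable f := Measurable.indicator (by fun_prop) measurableSet_Iic
  calc ∫⁻ z in Metric.closedBall 0 r, decay ε z ^ 2 * ENNReal.ofReal (‖z‖ + ε) ^ S
      = ∫⁻ z : Torus, f ‖z‖ := by
        rw [← lintegral_indicator measurableSet_closedBall]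
        simp only [f, w, decay, indicator, mem_closedBall_zero_iff, mem_Iic]
    _ ≤ 64 * ∫⁻ s in Ioi (0 : ℝ), ENNReal.ofReal (s ^ 3) * f s := lintegral_torus_fun_norm_le hf
    _ = 64 * ∫⁻ s in Ioc 0 r, ENNReal.ofReal (s ^ 3) * (((w s ^ 2)⁻¹) ^ 2 * w s ^ S) := by
        rw [← Ioi_inter_Iic, inter_comm, ← setLIntegral_indicator measurableSet_Iic]
        exact congrArg _ <| lintegral_congr fun s ↦ (indicator_mul_right _
          (fun s ↦ ENNReal.ofReal (s ^ 3)) fun s ↦ ((w s ^ 2)⁻¹) ^ 2 * w s ^ S).symm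
    _ ≤ 64 * ∫⁻ s in Ioc 0 r, (w s)⁻¹ * w s ^ S := by
        refine mul_le_mul_right (setLIntegral_mono' measurableSet_Ioc fun s hs ↦ ?_) _
        have hw : w s * (w s)⁻¹ = 1 := ENNReal.mul_inv_cancel
          (by simpa [w] using add_pos hs.1 hε) ENNReal.ofReal_ne_top
        calc ENNReal.ofReal (s ^ 3) * (((w s ^ 2)⁻¹) ^ 2 * w s ^ S)
            ≤ w s ^ 3 * (((w s)⁻¹ ^ 2) ^ 2 * w s ^ S) := by
              rw [ENNReal.ofReal_pow hs.1.le, ENNReal.inv_pow]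
              gcongr
              exact ENNReal.ofReal_le_ofReal (by linarith)
          _ = (w s * (w s)⁻¹) ^ 3 * ((w s)⁻¹ * w s ^ S) := by ring
          _ = (w s)⁻¹ * w s ^ S := by rw [hw, one_pow, one_mul]
    _ ≤ _ := by
        grw [lintegral_Ioc_pow_mul_inv_add_le hε hε1 hr hr4 S]
        rw [← mul_assoc, ← mul_assoc]
        norm_num

theorem decay_sub_comm (ε : ℝ) (x y : Torus) : decay ε (x - y) = decay ε (y - x) := by
  rw [decay, decay, norm_sub_rev]

theorem decay_mul_sq {ε : ℝ} (hε : 0 < ε) (z : Torus) :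
    decay ε z * ENNReal.ofReal (‖z‖ + ε) ^ 2 = 1 := by
  refine ENNReal.inv_mul_cancel (pow_ne_zero 2 ?_) (ENNReal.pow_ne_top ENNReal.ofReal_ne_top)
  simpa using add_pos_of_nonneg_of_pos (norm_nonneg z) hε

theorem decay_le_decay {ε : ℝ} {z z' : Torus} (h : ‖z‖ ≤ ‖z'‖) : decay ε z' ≤ decay ε z := by
  unfold decay
  gcongr

theorem lintegral_decay_le {ε : ℝ} (hε : 0 < ε) (hε1 : ε < 1) :
    ∫⁻ z, decay ε z ≤ 3200 := by
  have huniv : Metric.closedBall (0 : Torus) 4 = univ :=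
    eq_univ_of_forall fun z ↦ by simpa using (norm_torus_le_pi z).trans Real.pi_le_four
  calc ∫⁻ z, decay ε z
      = ∫⁻ z in Metric.closedBall 0 4, decay ε z ^ 2 * ENNReal.ofReal (‖z‖ + ε) ^ 2 := by
        simp only [sq (decay ε _), mul_assoc, decay_mul_sq hε, mul_one, huniv,
          Measure.restrict_univ]
    _ ≤ 128 * 1 * ENNReal.ofReal (4 + ε) ^ 2 :=
        setLIntegral_decay_sq_mul_le hε hε1 zero_le_four le_rfl 2
    _ ≤ 128 * 1 * ENNReal.ofReal 5 ^ 2 := by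
        gcongr
        linarith
    _ = 3200 := by norm_num

/-- Families of points of the torus with increasing norms, all of them at most `r`. -/
def orderedSet (N : ℕ) (r : ℝ) : Set (Fin N → Torus) :=
  {z | Monotone (fun i ↦ ‖z i‖) ∧ ∀ i, ‖z i‖ ≤ r}

theorem measurableSet_orderedSet (N : ℕ) (r : ℝ) : MeasurableSet (orderedSet N r) := by
  simp only [orderedSet, Monotone, ofPred_and, ofPred_forall]
  refine .inter (.iInter fun i ↦ .iInter fun j ↦ .iInter fun _ ↦ ?_) (.iInter fun i ↦ ?_)
  all_goals exact measurableSet_le (by fun_prop) (by fun_prop)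

theorem snoc_mem_orderedSet {N : ℕ} {r : ℝ} {x : Torus} {z : Fin N → Torus} :
    (Fin.snoc z x : Fin (N + 1) → Torus) ∈ orderedSet (N + 1) r ↔
      ‖x‖ ≤ r ∧ z ∈ orderedSet N ‖x‖ := by
  constructor
  · rintro ⟨hmono, hle⟩
    exact ⟨by simpa using hle (Fin.last N),
      fun i j hij ↦ by simpa using hmono (Fin.castSucc_le_castSucc_iff.2 hij),
      fun i ↦ by simpa using hmono (Fin.le_last i.castSucc)⟩
  · rintro ⟨hx, hmono, hle⟩
    refine ⟨fun i j hij ↦ ?_, Fin.lastCases (by simpa) fun i ↦ by simpa using (hle i).trans hx⟩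
    induction j using Fin.lastCases with
    | last => exact Fin.lastCases (by simp) (fun i ↦ by simpa using hle i) i
    | cast j =>
      obtain ⟨i, rfl⟩ := Fin.exists_castSucc_eq.2 (hij.trans_lt (Fin.castSucc_lt_last j)).ne
      simpa using hmono (Fin.castSucc_le_castSucc_iff.1 hij)

theorem lintegral_fin_snoc {X : Type*} [MeasureSpace X] [SigmaFinite (volume : Measure X)] {N : ℕ}
    {f : (Fin (N + 1) → X) → ℝ≥0∞} (hf : Measurable f) :
    ∫⁻ z, f z = ∫⁻ x, ∫⁻ z : Fin N → X, f (Fin.snoc z x) := by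
  have hm := volume_preserving_piFinSuccAbove (fun _ : Fin (N + 1) ↦ X) (Fin.last N)
  calc ∫⁻ z, f z
      = ∫⁻ p, f ((MeasurableEquiv.piFinSuccAbove (fun _ ↦ X) (Fin.last N)).symm p) :=
        (hm.symm.lintegral_comp hf).symm
    _ = ∫⁻ x, ∫⁻ z : Fin N → X,
          f ((MeasurableEquiv.piFinSuccAbove (fun _ ↦ X) (Fin.last N)).symm (x, z)) :=
        lintegral_prod _ (hf.comp hm.symm.measurable).aemeasurable
    _ = ∫⁻ x, ∫⁻ z : Fin N → X, f (Fin.snoc z x) := by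
        simp only [MeasurableEquiv.piFinSuccAbove_symm_apply, Fin.insertNthEquiv_last]
        rfl

theorem setLIntegral_orderedSet_succ {N : ℕ} {r : ℝ} {g : Torus → ℝ≥0∞}
    (hg : Measurable g) {f : (Fin N → Torus) → ℝ≥0∞} (hf : Measurable f) :
    ∫⁻ z in orderedSet (N + 1) r, f (fun i ↦ z i.castSucc) * g (z (Fin.last N)) =
      ∫⁻ x in Metric.closedBall 0 r, g x * ∫⁻ z in orderedSet N ‖x‖, f z := by
  have hmeas : Measurable fun z : Fin (N + 1) → Torus ↦
      f (fun i ↦ z i.castSucc) * g (z (Fin.last N)) := by fun_prop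
  rw [← lintegral_indicator (measurableSet_orderedSet _ _), lintegral_fin_snoc
    (hmeas.indicator (measurableSet_orderedSet _ _)),
    ← lintegral_indicator measurableSet_closedBall]
  refine lintegral_congr fun x ↦ ?_
  by_cases hx : ‖x‖ ≤ r
  · rw [indicator_of_mem (by simpa using hx), mul_comm (g x), ← lintegral_mul_const _ hf,
      ← lintegral_indicator (measurableSet_orderedSet _ _)]
    refine lintegral_congr fun z ↦ ?_
    have hmem : (Fin.snoc z x : Fin (N + 1) → Torus) ∈ orderedSet (N + 1) r ↔
        z ∈ orderedSet N ‖x‖ := snoc_mem_orderedSet.trans (and_iff_right hx)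
    by_cases hz : z ∈ orderedSet N ‖x‖
    · rw [indicator_of_mem (hmem.2 hz), indicator_of_mem hz]
      simp only [Fin.snoc_castSucc, Fin.snoc_last]
    · rw [indicator_of_notMem (hmem.not.2 hz), indicator_of_notMem hz]
  · have hmem : ∀ z, (Fin.snoc z x : Fin (N + 1) → Torus) ∉ orderedSet (N + 1) r :=
      fun z hz ↦ hx (snoc_mem_orderedSet.1 hz).1
    rw [indicator_of_notMem (by simpa using hx)]
    simp only [indicator_of_notMem (hmem _), lintegral_zero]

theorem decay_pow_mul_pow_eq {ε : ℝ} (hε : 0 < ε) (z : Torus) {c S S' : ℕ}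
    (h : S' + 2 * c = S + 4) :
    decay ε z ^ c * ENNReal.ofReal (‖z‖ + ε) ^ S =
      decay ε z ^ 2 * ENNReal.ofReal (‖z‖ + ε) ^ S' := by
  set w := ENNReal.ofReal (‖z‖ + ε)
  have hw : decay ε z * w ^ 2 = 1 := decay_mul_sq hε z
  calc decay ε z ^ c * w ^ S
      = decay ε z ^ c * w ^ S * (decay ε z * w ^ 2) ^ 2 := by rw [hw, one_pow, mul_one]
    _ = decay ε z ^ c * decay ε z ^ 2 * w ^ (S + 4) := by ring
    _ = decay ε z ^ 2 * w ^ S' * (decay ε z * w ^ 2) ^ c := by rw [← h]; ring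
    _ = decay ε z ^ 2 * w ^ S' := by rw [hw, one_pow, mul_one]

-- Integrating out `z 0, z 1, …` in turn leaves `(‖z i‖ + ε) ^ S i` in front of the next factor;
-- a logarithm appears precisely when the exponent drops to zero.
theorem setLIntegral_orderedSet_le {ε : ℝ} (hε : 0 < ε) (hε1 : ε < 1) {c S : ℕ → ℕ}
    (hS0 : S 0 = 0) {N : ℕ} (hS : ∀ i < N, S (i + 1) + 2 * c i = S i + 4) {r : ℝ} (hr : 0 ≤ r)
    (hr4 : r ≤ 4) :
    ∫⁻ z in orderedSet N r, ∏ i, decay ε (z i) ^ c i ≤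
      128 ^ N * logFactor ε ^ Nat.count (fun i ↦ S (i + 1) = 0) N *
        ENNReal.ofReal (r + ε) ^ S N := by
  induction N generalizing r with
  | zero => exact (setLIntegral_le_lintegral _ _).trans (by simp [hS0, volume_pi])
  | succ N ih =>
    let K := 128 ^ N * logFactor ε ^ Nat.count (fun i ↦ S (i + 1) = 0) N
    calc ∫⁻ z in orderedSet (N + 1) r, ∏ i, decay ε (z i) ^ c i
        = ∫⁻ x in Metric.closedBall 0 r,
            decay ε x ^ c N * ∫⁻ z in orderedSet N ‖x‖, ∏ i, decay ε (z i) ^ c i := by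
          rw [← setLIntegral_orderedSet_succ (by fun_prop) (by fun_prop)]
          simp only [Fin.prod_univ_castSucc, Fin.val_castSucc, Fin.val_last]
      _ ≤ ∫⁻ x in Metric.closedBall 0 r,
            decay ε x ^ c N * (K * ENNReal.ofReal (‖x‖ + ε) ^ S N) := by
          refine setLIntegral_mono' measurableSet_closedBall fun x hx ↦ ?_
          have hxr : ‖x‖ ≤ r := by simpa using hx
          gcongr
          exact ih (fun i hi ↦ hS i (by lia)) (norm_nonneg x) (hxr.trans hr4)
      _ = K * ∫⁻ x in Metric.closedBall 0 r,
            decay ε x ^ 2 * ENNReal.ofReal (‖x‖ + ε) ^ S (N + 1) := by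
          rw [← lintegral_const_mul _ (by fun_prop)]
          refine lintegral_congr fun x ↦ ?_
          rw [← decay_pow_mul_pow_eq hε x (hS N N.lt_succ_self), mul_left_comm]
      _ ≤ _ := by
          grw [setLIntegral_decay_sq_mul_le hε hε1 hr hr4]
          refine le_of_eq ?_
          simp only [K, Nat.count_succ]
          split_ifs <;> ring

theorem heatKernel_nonneg (t : ℝ) (u : EuclideanSpace ℝ (Fin 4)) : 0 ≤ heatKernel t u := by
  unfold heatKernel
  positivity

@[fun_prop]
theorem measurable_heatKernel :
    Measurable fun p : ℝ × EuclideanSpace ℝ (Fin 4) ↦ heatKernel p.1 p.2 := by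
  unfold heatKernel
  fun_prop

theorem lintegral_inv_sq_mul_exp_neg_div {b : ℝ} (hb : 0 < b) :
    ∫⁻ t in Ioi (0 : ℝ), ENNReal.ofReal ((t ^ 2)⁻¹ * Real.exp (-(b / t))) =
      ENNReal.ofReal b⁻¹ := by
  calc ∫⁻ t in Ioi (0 : ℝ), ENNReal.ofReal ((t ^ 2)⁻¹ * Real.exp (-(b / t)))
      = ∫⁻ t in Ioi (0 : ℝ), ENNReal.ofReal |-(t ^ 2)⁻¹| *
          ENNReal.ofReal (Real.exp (-b * t⁻¹)) := by
        refine lintegral_congr fun t ↦ ?_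
        rw [abs_neg, abs_of_nonneg (by positivity), ENNReal.ofReal_mul (by positivity), neg_mul,
          div_eq_mul_inv]
    _ = ∫⁻ s in (fun t ↦ t⁻¹) '' Ioi (0 : ℝ), ENNReal.ofReal (Real.exp (-b * s)) :=
        (lintegral_image_eq_lintegral_abs_deriv_mul measurableSet_Ioi
          (fun t (ht : 0 < t) ↦ (hasDerivAt_inv ht.ne').hasDerivWithinAt)
          inv_injective.injOn fun s ↦ ENNReal.ofReal (Real.exp (-b * s))).symm
    _ = ∫⁻ s in Ioi (0 : ℝ), ENNReal.ofReal (Real.exp (-b * s)) := by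
        have : (Ioi (0 : ℝ))⁻¹ = Ioi 0 := by ext; simp
        rw [image_inv_eq_inv, this]
    _ = ENNReal.ofReal b⁻¹ := by
        rw [← ofReal_integral_eq_lintegral_ofReal
          (integrableOn_exp_mul_Ioi (neg_lt_zero.2 hb) 0) (.of_forall fun _ ↦ Real.exp_nonneg _),
          integral_exp_mul_Ioi (neg_lt_zero.2 hb)]
        simp

/-- The Green's function of `1 - Δ` on `ℝ⁴`, whose periodisation is `green`. -/
noncomputable def freeGreen (u : EuclideanSpace ℝ (Fin 4)) : ℝ≥0∞ :=
  ∫⁻ t in Ioi (0 : ℝ), ENNReal.ofReal (Real.exp (-t) * heatKernel t u)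

@[fun_prop]
theorem measurable_freeGreen : Measurable freeGreen :=
  Measurable.lintegral_prod_right' (f := fun p : EuclideanSpace ℝ (Fin 4) × ℝ ↦
    ENNReal.ofReal (Real.exp (-p.2) * heatKernel p.2 p.1)) <| by
      have := measurable_heatKernel.comp (measurable_swap (α := EuclideanSpace ℝ (Fin 4)) (β := ℝ))
      fun_prop

theorem exp_neg_mul_heatKernel_le {t : ℝ} (ht : 0 < t) (u : EuclideanSpace ℝ (Fin 4)) :
    Real.exp (-t) * heatKernel t u ≤
      Real.exp (-(‖u‖ / 2)) / 16 * ((t ^ 2)⁻¹ * Real.exp (-(‖u‖ ^ 2 / 8 / t))) := by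
  have hexp : -t + -(‖u‖ ^ 2) / (4 * t) ≤ -(‖u‖ / 2) + -(‖u‖ ^ 2 / 8 / t) := by
    have h : t + ‖u‖ ^ 2 / (4 * t) - (‖u‖ / 2 + ‖u‖ ^ 2 / 8 / t) =
        ((t - ‖u‖ / 4) ^ 2 + ‖u‖ ^ 2 / 16) / t := by
      field_simp
      ring
    have : 0 ≤ ((t - ‖u‖ / 4) ^ 2 + ‖u‖ ^ 2 / 16) / t := by positivity
    rw [neg_div]
    linarith
  have hpre : 1 / (4 * Real.pi * t) ^ 2 ≤ (t ^ 2)⁻¹ / 16 := by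
    rw [one_div, mul_right_comm, mul_pow, mul_inv, mul_pow, mul_inv, div_eq_mul_inv]
    have : (Real.pi ^ 2)⁻¹ ≤ 1 := inv_le_one_of_one_le₀ <|
      one_le_pow₀ (by linarith [Real.pi_gt_three])
    calc _ ≤ (4 ^ 2 : ℝ)⁻¹ * (t ^ 2)⁻¹ * 1 := by gcongr
      _ = _ := by ring
  calc Real.exp (-t) * heatKernel t u
      = 1 / (4 * Real.pi * t) ^ 2 * Real.exp (-t + -(‖u‖ ^ 2) / (4 * t)) := by
        rw [heatKernel, Real.exp_add, mul_left_comm]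
    _ ≤ (t ^ 2)⁻¹ / 16 * Real.exp (-(‖u‖ / 2) + -(‖u‖ ^ 2 / 8 / t)) := by gcongr
    _ = _ := by rw [Real.exp_add]; ring

theorem freeGreen_le (u : EuclideanSpace ℝ (Fin 4)) :
    freeGreen u ≤ ENNReal.ofReal (Real.exp (-(‖u‖ / 2))) * (‖u‖ₑ ^ 2)⁻¹ := by
  rcases eq_or_ne u 0 with rfl | hu
  · simp
  calc freeGreen u
      ≤ ∫⁻ t in Ioi (0 : ℝ), ENNReal.ofReal (Real.exp (-(‖u‖ / 2)) / 16) *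
          ENNReal.ofReal ((t ^ 2)⁻¹ * Real.exp (-(‖u‖ ^ 2 / 8 / t))) :=
        setLIntegral_mono' measurableSet_Ioi fun t ht ↦ by
          rw [← ENNReal.ofReal_mul (by positivity)]
          exact ENNReal.ofReal_le_ofReal (exp_neg_mul_heatKernel_le ht u)
    _ = ENNReal.ofReal (Real.exp (-(‖u‖ / 2)) / 16 * (‖u‖ ^ 2 / 8)⁻¹) := by
        rw [lintegral_const_mul _ (by fun_prop), lintegral_inv_sq_mul_exp_neg_div (by positivity),
          ← ENNReal.ofReal_mul (by positivity)]
    _ ≤ ENNReal.ofReal (Real.exp (-(‖u‖ / 2)) * (‖u‖ ^ 2)⁻¹) := by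
        refine ENNReal.ofReal_le_ofReal ?_
        calc _ = Real.exp (-(‖u‖ / 2)) * (‖u‖ ^ 2)⁻¹ * (1 / 2) := by ring
          _ ≤ _ := mul_le_of_le_one_right (by positivity) (by norm_num)
    _ = _ := by
        rw [ENNReal.ofReal_mul (Real.exp_nonneg _), ENNReal.ofReal_inv_of_pos (by positivity),
          ENNReal.ofReal_pow (norm_nonneg u), ofReal_norm]

theorem lintegral_inv_enorm_sq_ball_lt_top :
    ∫⁻ v in Metric.ball (0 : EuclideanSpace ℝ (Fin 4)) 1, (‖v‖ₑ ^ 2)⁻¹ < ∞ := by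
  let f : ℝ → ℝ≥0∞ := (Iio 1).indicator fun s ↦ (ENNReal.ofReal s ^ 2)⁻¹
  have hf : Measurable f := Measurable.indicator (by fun_prop) measurableSet_Iio
  calc ∫⁻ v in Metric.ball (0 : EuclideanSpace ℝ (Fin 4)) 1, (‖v‖ₑ ^ 2)⁻¹
      = ∫⁻ v : EuclideanSpace ℝ (Fin 4), f ‖v‖ := by
        rw [← lintegral_indicator measurableSet_ball]
        simp only [f, indicator, mem_ball_zero_iff, mem_Iio, ofReal_norm]
    _ = _ := lintegral_fun_norm_eq volume hf
    _ ≤ finrank ℝ (EuclideanSpace ℝ (Fin 4)) *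
          volume (Metric.ball (0 : EuclideanSpace ℝ (Fin 4)) 1) *
          ∫⁻ s in Ioi (0 : ℝ), (Iio 1).indicator (fun _ ↦ 1) s := by
        refine mul_le_mul_right (setLIntegral_mono' measurableSet_Ioi fun s hs ↦ ?_) _
        by_cases hs1 : s < 1
        · simp only [f, indicator_of_mem (mem_Iio.2 hs1), finrank_euclideanSpace_fin]
          rw [ENNReal.ofReal_pow (le_of_lt hs)]
          refine ENNReal.div_le_of_le_mul ?_
          rw [pow_succ']
          gcongr
          exact ENNReal.ofReal_le_one.2 hs1.le
        · simp [f, hs1]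
    _ < ∞ := by
        rw [setLIntegral_indicator measurableSet_Iio, Iio_inter_Ioi]
        simp [ENNReal.mul_lt_top, measure_ball_lt_top]

theorem inv_enorm_sq_le (v : EuclideanSpace ℝ (Fin 4)) :
    (‖v‖ₑ ^ 2)⁻¹ ≤ 1 + (Metric.ball 0 1).indicator (fun v ↦ (‖v‖ₑ ^ 2)⁻¹) v := by
  by_cases hv : v ∈ Metric.ball 0 1
  · rw [indicator_of_mem hv]
    exact le_add_self
  · refine (ENNReal.inv_le_one.2 (one_le_pow₀ ?_)).trans le_self_add
    simpa [← ofReal_norm] using hv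

theorem ofReal_norm_add_one_sq_mul_inv_le {R : ℝ≥0} {v w : EuclideanSpace ℝ (Fin 4)}
    (hw : ‖w‖ ≤ R) :
    ENNReal.ofReal (‖v‖ + 1) ^ 2 * (‖v - w‖ₑ ^ 2)⁻¹ ≤
      2 * (1 + (R + 1) ^ 2 * (‖v - w‖ₑ ^ 2)⁻¹) := by
  have htri : ‖v‖ + 1 ≤ ‖v - w‖ + (R + 1) := by linarith [norm_sub_norm_le v w]
  calc ENNReal.ofReal (‖v‖ + 1) ^ 2 * (‖v - w‖ₑ ^ 2)⁻¹
      ≤ ENNReal.ofReal (2 * (‖v - w‖ ^ 2 + (R + 1) ^ 2)) * (‖v - w‖ₑ ^ 2)⁻¹ := by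
        rw [← ENNReal.ofReal_pow (by positivity)]
        gcongr
        exact (pow_le_pow_left₀ (by positivity) htri 2).trans add_sq_le
    _ = 2 * (‖v - w‖ₑ ^ 2 + (R + 1) ^ 2) * (‖v - w‖ₑ ^ 2)⁻¹ := by
        rw [ENNReal.ofReal_mul zero_le_two, ENNReal.ofReal_add (by positivity) (by positivity),
          ENNReal.ofReal_pow (by positivity), ENNReal.ofReal_pow (by positivity), ofReal_norm,
          ENNReal.ofReal_add R.coe_nonneg zero_le_one, ENNReal.ofReal_coe_nnreal,
          ENNReal.ofReal_one, ENNReal.ofReal_ofNat]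
    _ = 2 * (‖v - w‖ₑ ^ 2 * (‖v - w‖ₑ ^ 2)⁻¹ + (R + 1) ^ 2 * (‖v - w‖ₑ ^ 2)⁻¹) := by ring
    _ ≤ _ := by grw [ENNReal.mul_inv_le_one]

theorem exists_lintegral_inv_enorm_sub_sq_le (R : ℝ≥0) :
    ∃ B : ℝ≥0, ∀ v : EuclideanSpace ℝ (Fin 4),
      ∫⁻ w in Metric.closedBall 0 R, (‖v - w‖ₑ ^ 2)⁻¹ ≤
        B * (ENNReal.ofReal (‖v‖ + 1) ^ 2)⁻¹ := by
  let h : EuclideanSpace ℝ (Fin 4) → ℝ≥0∞ := (Metric.ball 0 1).indicator fun v ↦ (‖v‖ₑ ^ 2)⁻¹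
  have hh : Measurable h := Measurable.indicator (by fun_prop) measurableSet_ball
  let B : ℝ≥0∞ :=
    2 * (1 + (R + 1) ^ 2) * volume (Metric.closedBall (0 : EuclideanSpace ℝ (Fin 4)) R) +
      2 * (R + 1) ^ 2 * ∫⁻ v, h v
  have hB : B ≠ ∞ := by
    have : ∫⁻ v, h v ≠ ∞ := by
      rw [lintegral_indicator measurableSet_ball]
      exact lintegral_inv_enorm_sq_ball_lt_top.ne
    have hvol := measure_closedBall_lt_top (μ := volume) (x := (0 : EuclideanSpace ℝ (Fin 4)))
      (r := R)
    finiteness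
  refine ⟨B.toNNReal, fun v ↦ ?_⟩
  have hpos : ENNReal.ofReal (‖v‖ + 1) ^ 2 ≠ 0 := pow_ne_zero 2 <| by
    simpa using add_pos_of_nonneg_of_pos (norm_nonneg v) one_pos
  rw [ENNReal.coe_toNNReal hB, ← div_eq_mul_inv,
    ENNReal.le_div_iff_mul_le (.inl hpos) (.inl (by finiteness)), mul_comm,
    ← lintegral_const_mul _ (by fun_prop)]
  calc ∫⁻ w in Metric.closedBall 0 R, ENNReal.ofReal (‖v‖ + 1) ^ 2 * (‖v - w‖ₑ ^ 2)⁻¹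
      ≤ ∫⁻ w in Metric.closedBall 0 R, (2 * (1 + (R + 1) ^ 2) + 2 * (R + 1) ^ 2 * h (v - w)) := by
        refine setLIntegral_mono' measurableSet_closedBall fun w hw ↦ ?_
        grw [ofReal_norm_add_one_sq_mul_inv_le (by simpa using hw), inv_enorm_sq_le]
        exact le_of_eq (by ring)
    _ ≤ 2 * (1 + (R + 1) ^ 2) * volume (Metric.closedBall (0 : EuclideanSpace ℝ (Fin 4)) R) +
          ∫⁻ w, 2 * (R + 1) ^ 2 * h (v - w) := by
        rw [lintegral_add_left (by fun_prop), setLIntegral_const]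
        exact add_le_add_right (setLIntegral_le_lintegral _ _) _
    _ = B := by
        rw [lintegral_const_mul _ (by fun_prop), lintegral_sub_left_eq_self h v]

theorem exists_lintegral_inv_enorm_sub_smul_sq_le (R : ℝ≥0) :
    ∃ B : ℝ≥0, ∀ ε : ℝ, 0 < ε → ∀ u : EuclideanSpace ℝ (Fin 4),
      ∫⁻ w in Metric.closedBall 0 R, (‖u - ε • w‖ₑ ^ 2)⁻¹ ≤
        B * (ENNReal.ofReal (‖u‖ + ε) ^ 2)⁻¹ := by
  obtain ⟨B, hB⟩ := exists_lintegral_inv_enorm_sub_sq_le R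
  refine ⟨B, fun ε hε u ↦ ?_⟩
  obtain ⟨v, rfl⟩ : ∃ v, u = ε • v := ⟨ε⁻¹ • u, (smul_inv_smul₀ hε.ne' u).symm⟩
  have hscale (c : ℝ≥0∞) :
      ((ENNReal.ofReal ε * c) ^ 2)⁻¹ = (ENNReal.ofReal ε ^ 2)⁻¹ * (c ^ 2)⁻¹ := by
    rw [mul_pow, ENNReal.mul_inv]
    · exact .inl (by simpa using hε)
    · exact .inl (by finiteness)
  calc ∫⁻ w in Metric.closedBall 0 R, (‖ε • v - ε • w‖ₑ ^ 2)⁻¹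
      = (ENNReal.ofReal ε ^ 2)⁻¹ * ∫⁻ w in Metric.closedBall 0 R, (‖v - w‖ₑ ^ 2)⁻¹ := by
        rw [← lintegral_const_mul _ (by fun_prop)]
        simp only [← smul_sub, enorm_smul, Real.enorm_of_nonneg hε.le, hscale]
    _ ≤ (ENNReal.ofReal ε ^ 2)⁻¹ * (B * (ENNReal.ofReal (‖v‖ + 1) ^ 2)⁻¹) := by grw [hB]
    _ = B * (ENNReal.ofReal (‖ε • v‖ + ε) ^ 2)⁻¹ := by
        rw [mul_left_comm, ← hscale, ← ENNReal.ofReal_mul hε.le, norm_smul,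
          Real.norm_of_nonneg hε.le, mul_add_one]

theorem tsum_pi_prod {α : Type*} (g : α → ℝ≥0∞) (d : ℕ) :
    ∑' n : Fin d → α, ∏ i, g (n i) = (∑' a, g a) ^ d := by
  induction d with
  | zero => simp
  | succ d ih =>
    rw [← (Fin.consEquiv fun _ : Fin (d + 1) ↦ α).tsum_eq]
    simp only [Fin.consEquiv, Equiv.coe_fn_mk, Fin.prod_univ_succ, Fin.cons_zero, Fin.cons_succ]
    rw [ENNReal.tsum_prod (f := fun a (n : Fin d → α) ↦ g a * ∏ i, g (n i))]
    simp only [ENNReal.tsum_mul_left, ih, ENNReal.tsum_mul_right, pow_succ']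

theorem tsum_exp_neg_abs_ne_top {c : ℝ} (hc : 0 < c) :
    ∑' a : ℤ, ENNReal.ofReal (Real.exp (-(c * |(a : ℝ)|))) ≠ ∞ := by
  have hnat : Summable fun k : ℕ ↦ Real.exp (-(c * k)) := by
    simpa only [mul_neg, mul_comm] using Real.summable_exp_nat_mul_iff.2 (neg_lt_zero.2 hc)
  have hs : Summable fun a : ℤ ↦ Real.exp (-(c * |(a : ℝ)|)) :=
    .of_nat_of_neg (by simpa using hnat) (by simpa using hnat)
  exact hs.tsum_ofReal_ne_top

theorem exists_toTorus_eq (x : Torus) : ∃ ξ : EuclideanSpace ℝ (Fin 4),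
    toTorus ξ = x ∧ ∀ i, |ξ i| ≤ Real.pi := by
  refine ⟨WithLp.toLp 2 fun i ↦ AddCircle.equivIoc (2 * Real.pi) (-Real.pi) (x i),
    funext fun i ↦ by simp [toTorus, AddCircle.coe_equivIoc], fun i ↦ ?_⟩
  have := (AddCircle.equivIoc (2 * Real.pi) (-Real.pi) (x i)).2
  exact abs_le.2 ⟨this.1.le, by linarith [this.2]⟩

theorem norm_toTorus_le (u : EuclideanSpace ℝ (Fin 4)) : ‖toTorus u‖ ≤ ‖u‖ :=
  (pi_norm_le_iff_of_nonneg (norm_nonneg u)).2 fun i ↦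
    (QuotientAddGroup.norm_mk_le_norm (m := u i)).trans (PiLp.norm_apply_le u i)

/-- The vectors of the lattice `(2πℤ)⁴`, the kernel of `toTorus`. -/
noncomputable def latticeVec (n : Fin 4 → ℤ) : EuclideanSpace ℝ (Fin 4) :=
  WithLp.toLp 2 fun i ↦ 2 * Real.pi * n i

theorem toTorus_sub (u v : EuclideanSpace ℝ (Fin 4)) :
    toTorus (u - v) = toTorus u - toTorus v := rfl

theorem toTorus_eq_iff {u v : EuclideanSpace ℝ (Fin 4)} :
    toTorus v = toTorus u ↔ ∃ n, v = u + latticeVec n := by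
  have hcoord : ∀ i, (v i : AddCircle (2 * Real.pi)) = u i ↔
      ∃ m : ℤ, v i = u i + 2 * Real.pi * m := fun i ↦ by
    rw [← sub_eq_zero, ← AddCircle.coe_sub, AddCircle.coe_eq_zero_iff]
    simp only [zsmul_eq_mul, eq_sub_iff_add_eq', mul_comm, eq_comm]
  simp only [toTorus, funext_iff, hcoord, Classical.skolem, PiLp.ext_iff, PiLp.add_apply,
    latticeVec]

theorem enorm_torusHeatKernel_le (t : ℝ) (u : EuclideanSpace ℝ (Fin 4)) :
    ‖torusHeatKernel t (toTorus u)‖ₑ ≤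
      ∑' n, ENNReal.ofReal (heatKernel t (u + latticeVec n)) := by
  choose n hn using fun y : {y // toTorus y = toTorus u} ↦ toTorus_eq_iff.1 y.2
  have hinj : Function.Injective n := fun y y' h ↦ Subtype.ext (by rw [hn y, hn y', h])
  calc ‖torusHeatKernel t (toTorus u)‖ₑ
      ≤ ∑' y : {y // toTorus y = toTorus u}, ‖heatKernel t y‖ₑ := enorm_tsum_le_tsum_enorm
    _ = ∑' y, ENNReal.ofReal (heatKernel t (u + latticeVec (n y))) :=
        tsum_congr fun y ↦ by rw [← hn y, Real.enorm_of_nonneg (heatKernel_nonneg _ _)]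
    _ ≤ _ := ENNReal.tsum_comp_le_tsum_of_injective hinj _

theorem enorm_green_le (u : EuclideanSpace ℝ (Fin 4)) :
    ‖green (toTorus u)‖ₑ ≤ ∑' n, freeGreen (u + latticeVec n) := by
  calc ‖green (toTorus u)‖ₑ
      ≤ ∫⁻ t in Ioi (0 : ℝ), ‖Real.exp (-t) * torusHeatKernel t (toTorus u)‖ₑ :=
        enorm_integral_le_lintegral_enorm _
    _ ≤ ∫⁻ t in Ioi (0 : ℝ), ∑' n,
          ENNReal.ofReal (Real.exp (-t) * heatKernel t (u + latticeVec n)) := by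
        refine lintegral_mono fun t ↦ ?_
        simp only [enorm_mul, Real.enorm_of_nonneg (Real.exp_nonneg _),
          ENNReal.ofReal_mul (Real.exp_nonneg _), ENNReal.tsum_mul_left]
        grw [enorm_torusHeatKernel_le]
    _ = ∑' n, freeGreen (u + latticeVec n) := lintegral_tsum fun n ↦ by
        have : Measurable fun t ↦ heatKernel t (u + latticeVec n) :=
          measurable_heatKernel.comp measurable_prodMk_right
        fun_prop

theorem pi_mul_abs_le_norm_add_latticeVec {ξ : EuclideanSpace ℝ (Fin 4)}
    (hξ : ∀ i, |ξ i| ≤ Real.pi) (n : Fin 4 → ℤ) (i : Fin 4) :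
    Real.pi * |(n i : ℝ)| ≤ ‖ξ + latticeVec n‖ := by
  refine le_trans ?_ (PiLp.norm_apply_le (ξ + latticeVec n) i)
  simp only [PiLp.add_apply, latticeVec, Real.norm_eq_abs]
  rcases eq_or_ne (n i) 0 with h0 | h0
  · simp [h0]
  · have hn : 1 ≤ |(n i : ℝ)| := mod_cast Int.one_le_abs h0
    have htri := abs_sub_abs_le_abs_add (2 * Real.pi * n i) (ξ i)
    rw [abs_mul, abs_of_pos Real.two_pi_pos, add_comm] at htri
    nlinarith [hξ i, Real.pi_pos]

theorem exp_neg_norm_add_latticeVec_le {ξ : EuclideanSpace ℝ (Fin 4)}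
    (hξ : ∀ i, |ξ i| ≤ Real.pi) (n : Fin 4 → ℤ) :
    Real.exp (-(‖ξ + latticeVec n‖ / 2)) ≤ ∏ i, Real.exp (-(1 / 4 * |(n i : ℝ)|)) := by
  rw [← Real.exp_sum, Real.exp_le_exp, Finset.sum_neg_distrib, neg_le_neg_iff,
    ← Finset.mul_sum]
  have hsum : ∑ i, Real.pi * |(n i : ℝ)| ≤ ∑ _ : Fin 4, ‖ξ + latticeVec n‖ :=
    Finset.sum_le_sum fun i _ ↦ pi_mul_abs_le_norm_add_latticeVec hξ n i
  have : 0 ≤ ∑ i, |(n i : ℝ)| := by positivity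
  rw [← Finset.mul_sum, Finset.sum_const, Finset.card_fin, nsmul_eq_mul,
    Nat.cast_ofNat] at hsum
  nlinarith [Real.pi_gt_three]

theorem exists_tsum_exp_mul_inv_norm_sq_le :
    ∃ T : ℝ≥0, ∀ ε : ℝ, ∀ x : Torus, ∃ ξ, toTorus ξ = x ∧
      ∑' n, ENNReal.ofReal (Real.exp (-(‖ξ + latticeVec n‖ / 2))) *
        (ENNReal.ofReal (‖ξ + latticeVec n‖ + ε) ^ 2)⁻¹ ≤ T * decay ε x := by
  let T : ℝ≥0∞ := (∑' a : ℤ, ENNReal.ofReal (Real.exp (-(1 / 4 * |(a : ℝ)|)))) ^ 4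
  have hT : T ≠ ∞ := ENNReal.pow_ne_top (tsum_exp_neg_abs_ne_top (by norm_num))
  refine ⟨T.toNNReal, fun ε x ↦ ?_⟩
  obtain ⟨ξ, rfl, hξ⟩ := exists_toTorus_eq x
  refine ⟨ξ, rfl, ?_⟩
  rw [ENNReal.coe_toNNReal hT]
  simp only [T]
  rw [← tsum_pi_prod, ← ENNReal.tsum_mul_right]
  refine ENNReal.tsum_le_tsum fun n ↦ ?_
  have hnorm : ‖toTorus ξ‖ ≤ ‖ξ + latticeVec n‖ := by
    rw [← toTorus_eq_iff.2 ⟨n, rfl⟩]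
    exact norm_toTorus_le _
  rw [decay, ← ENNReal.ofReal_prod_of_nonneg fun i _ ↦ Real.exp_nonneg _]
  grw [exp_neg_norm_add_latticeVec_le hξ, hnorm]

theorem greenMoll_eq_integral_smul (ρ : EuclideanSpace ℝ (Fin 4) → ℝ) {ε : ℝ} (hε : 0 < ε)
    (x : Torus) : greenMoll ρ ε x = ∫ w, ρ w * green (x - toTorus (ε • w)) := by
  have h := Measure.integral_comp_inv_smul (μ := volume)
    (fun w ↦ ρ w * green (x - toTorus (ε • w))) ε
  simp only [smul_inv_smul₀ hε.ne', finrank_euclideanSpace_fin, abs_of_pos (pow_pos hε 4)] at h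
  simp only [greenMoll, mul_assoc, integral_const_mul]
  rw [h, smul_eq_mul, inv_mul_cancel_left₀ (pow_pos hε 4).ne']

theorem enorm_greenMoll_le {ρ : EuclideanSpace ℝ (Fin 4) → ℝ} {R : ℝ≥0}
    (hR : tsupport ρ ⊆ Metric.closedBall 0 R) {ε : ℝ} (hε : 0 < ε)
    (ξ : EuclideanSpace ℝ (Fin 4)) :
    ‖greenMoll ρ ε (toTorus ξ)‖ₑ ≤ eLpNorm ρ ∞ volume *
      ∑' n, ∫⁻ w in Metric.closedBall 0 R, freeGreen (ξ + latticeVec n - ε • w) := by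
  calc ‖greenMoll ρ ε (toTorus ξ)‖ₑ
      ≤ ∫⁻ w, ‖ρ w‖ₑ * ‖green (toTorus (ξ - ε • w))‖ₑ := by
        rw [greenMoll_eq_integral_smul ρ hε]
        refine (enorm_integral_le_lintegral_enorm _).trans_eq ?_
        simp only [enorm_mul, toTorus_sub]
    _ = ∫⁻ w in Metric.closedBall 0 R, ‖ρ w‖ₑ * ‖green (toTorus (ξ - ε • w))‖ₑ := by
        refine (setLIntegral_eq_of_support_subset fun w hw ↦ hR <| subset_tsupport _ ?_).symm
        exact fun h ↦ hw (by simp [h])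
    _ ≤ ∫⁻ w in Metric.closedBall 0 R,
          eLpNorm ρ ∞ volume * ∑' n, freeGreen (ξ + latticeVec n - ε • w) := by
        refine lintegral_mono_ae (ae_restrict_of_ae ?_)
        filter_upwards [ae_le_eLpNormEssSup (f := ρ)] with w hw
        rw [← eLpNorm_exponent_top] at hw
        grw [hw, enorm_green_le]
        simp only [add_sub_right_comm, le_refl]
    _ = _ := by
        rw [lintegral_const_mul _ (Measurable.tsum fun n ↦ by fun_prop),
          lintegral_tsum fun n ↦ by fun_prop]

theorem exists_setLIntegral_freeGreen_le (R : ℝ≥0) :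
    ∃ B : ℝ≥0, ∀ ε : ℝ, 0 < ε → ε < 1 → ∀ u : EuclideanSpace ℝ (Fin 4),
      ∫⁻ w in Metric.closedBall 0 R, freeGreen (u - ε • w) ≤
        B * (ENNReal.ofReal (Real.exp (-(‖u‖ / 2))) * (ENNReal.ofReal (‖u‖ + ε) ^ 2)⁻¹) := by
  obtain ⟨B, hB⟩ := exists_lintegral_inv_enorm_sub_smul_sq_le R
  refine ⟨(Real.exp (R / 2)).toNNReal * B, fun ε hε hε1 u ↦ ?_⟩
  calc ∫⁻ w in Metric.closedBall 0 R, freeGreen (u - ε • w)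
      ≤ ∫⁻ w in Metric.closedBall 0 R, ENNReal.ofReal (Real.exp (R / 2 - ‖u‖ / 2)) *
          (‖u - ε • w‖ₑ ^ 2)⁻¹ := by
        refine setLIntegral_mono' measurableSet_closedBall fun w hw ↦ (freeGreen_le _).trans ?_
        have hεw : ‖ε • w‖ ≤ R := by
          rw [norm_smul, Real.norm_of_nonneg hε.le]
          exact (mul_le_of_le_one_left (norm_nonneg w) hε1.le).trans (by simpa using hw)
        gcongr
        linarith [norm_sub_norm_le u (ε • w)]
    _ ≤ ENNReal.ofReal (Real.exp (R / 2 - ‖u‖ / 2)) * (B * (ENNReal.ofReal (‖u‖ + ε) ^ 2)⁻¹) := by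
        rw [lintegral_const_mul _ (by fun_prop)]
        grw [hB ε hε u]
    _ = _ := by
        rw [sub_eq_add_neg, Real.exp_add, ENNReal.ofReal_mul (Real.exp_nonneg _), ENNReal.coe_mul,
          ENNReal.ofReal]
        ring

theorem exists_enorm_greenMoll_le {ρ : EuclideanSpace ℝ (Fin 4) → ℝ} (hρ : MemLp ρ ∞)
    (hsupp : HasCompactSupport ρ) :
    ∃ A : ℝ≥0, ∀ ε : ℝ, 0 < ε → ε < 1 → ∀ x : Torus, ‖greenMoll ρ ε x‖ₑ ≤ A * decay ε x := by
  obtain ⟨R, hR0, hR⟩ := hsupp.isCompact.isBounded.subset_closedBall_lt 0 0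
  lift R to ℝ≥0 using hR0.le
  obtain ⟨B, hB⟩ := exists_setLIntegral_freeGreen_le R
  obtain ⟨T, hT⟩ := exists_tsum_exp_mul_inv_norm_sq_le
  refine ⟨(eLpNorm ρ ∞ volume).toNNReal * B * T, fun ε hε hε1 x ↦ ?_⟩
  obtain ⟨ξ, rfl, hξ⟩ := hT ε x
  grw [enorm_greenMoll_le hR hε, ENNReal.tsum_le_tsum fun n ↦ hB ε hε hε1 (ξ + latticeVec n),
    ENNReal.tsum_mul_left, hξ]
  rw [ENNReal.coe_mul, ENNReal.coe_mul, ENNReal.coe_toNNReal hρ.2.ne, mul_assoc, mul_assoc]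

section Merging

variable {V E : Type*}

open Classical in
/-- Merges the fibres of `f` through the two points of `p`. Partitions of `V` are encoded throughout
as the fibres of a map `V → V`. -/
noncomputable def mergeStep (f : V → V) (p : V × V) (v : V) : V :=
  if f v = f p.2 then f p.1 else f v

/-- The partition obtained from the one into singletons by merging successively the classes of the
first `i` pairs of `s`. -/
noncomputable def mergeMap (s : ℕ → V × V) : ℕ → V → V
  | 0 => id
  | i + 1 => mergeStep (mergeMap s i) (s i)

/-- Each of the first `N` pairs of `s` joins two different classes, as in the construction of a
spanning tree. -/
def IsMerging (s : ℕ → V × V) (N : ℕ) : Prop :=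
  ∀ i < N, mergeMap s i (s i).1 ≠ mergeMap s i (s i).2

theorem mergeStep_eq_iff {f : V → V} {p : V × V} {u v : V} :
    mergeStep f p u = mergeStep f p v ↔
      f u = f v ∨ (f u = f p.1 ∧ f v = f p.2) ∨ (f u = f p.2 ∧ f v = f p.1) := by
  unfold mergeStep
  grind

theorem range_mergeStep {f : V → V} {p : V × V} (h : f p.1 ≠ f p.2) :
    range (mergeStep f p) = range f \ {f p.2} := by
  ext w
  simp only [mem_range, mem_sdiff, mem_singleton_iff, mergeStep]
  constructor
  · rintro ⟨v, rfl⟩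
    split_ifs with hv
    · exact ⟨⟨_, rfl⟩, h⟩
    · exact ⟨⟨_, rfl⟩, hv⟩
  · rintro ⟨⟨v, rfl⟩, hv⟩
    exact ⟨v, if_neg hv⟩

theorem mergeMap_succ_eq_iff {s : ℕ → V × V} {i : ℕ} {u v : V} :
    mergeMap s (i + 1) u = mergeMap s (i + 1) v ↔
      mergeMap s i u = mergeMap s i v ∨
      (mergeMap s i u = mergeMap s i (s i).1 ∧ mergeMap s i v = mergeMap s i (s i).2) ∨
      (mergeMap s i u = mergeMap s i (s i).2 ∧ mergeMap s i v = mergeMap s i (s i).1) :=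
  mergeStep_eq_iff

theorem mergeMap_eq_mono {s : ℕ → V × V} {i j : ℕ} (hij : i ≤ j) {u v : V}
    (h : mergeMap s i u = mergeMap s i v) : mergeMap s j u = mergeMap s j v := by
  induction hij with
  | refl => exact h
  | step _ ih => exact mergeMap_succ_eq_iff.2 (.inl ih)

theorem mergeMap_succ_pair (s : ℕ → V × V) (i : ℕ) :
    mergeMap s (i + 1) (s i).1 = mergeMap s (i + 1) (s i).2 :=
  mergeMap_succ_eq_iff.2 (.inr (.inl ⟨rfl, rfl⟩))

theorem IsMerging.mono {s : ℕ → V × V} {M N : ℕ} (h : IsMerging s N) (hMN : M ≤ N) :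
    IsMerging s M :=
  fun i hi ↦ h i (hi.trans_le hMN)

theorem IsMerging.ncard_range_mergeMap [Finite V] {s : ℕ → V × V} {N : ℕ}
    (h : IsMerging s N) : (range (mergeMap s N)).ncard + N = Nat.card V := by
  induction N with
  | zero => simp [mergeMap, range_id, ncard_univ]
  | succ N ih =>
    rw [← ih (h.mono N.le_succ), mergeMap, range_mergeStep (h N N.lt_succ_self),
      ← ncard_sdiff_singleton_add_one (mem_range_self (s N).2) (toFinite (range (mergeMap s N)))]
    lia

theorem IsMerging.mergeMap_eq [Finite V] {s : ℕ → V × V} {N : ℕ} (h : IsMerging s N)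
    (hN : Nat.card V = N + 1) (u v : V) : mergeMap s N u = mergeMap s N v := by
  have hcard := h.ncard_range_mergeMap
  exact (ncard_le_one_iff (toFinite _)).1 (by lia) (mem_range_self u) (mem_range_self v)

theorem IsMerging.exists_mergeMap_ne [Finite V] {s : ℕ → V × V} {N : ℕ} (h : IsMerging s N)
    (hN : N + 1 < Nat.card V) : ∃ u v, mergeMap s N u ≠ mergeMap s N v := by
  have hcard := h.ncard_range_mergeMap
  obtain ⟨_, _, ⟨u, rfl⟩, ⟨v, rfl⟩, huv⟩ :=
    (one_lt_ncard_iff (toFinite (range (mergeMap s N)))).1 (by lia)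
  exact ⟨u, v, huv⟩

theorem IsMerging.surjective_differences {T : Type*} [AddCommGroup T] {s : ℕ → V × V} {N : ℕ}
    (h : IsMerging s N) :
    Function.Surjective fun (x : V → T) (i : Fin N) ↦ x (s i).1 - x (s i).2 := by
  classical
  intro z
  induction N with
  | zero => exact ⟨fun _ ↦ 0, Subsingleton.elim _ _⟩
  | succ N ih =>
    obtain ⟨x, hx⟩ := ih (h.mono N.le_succ) fun i ↦ z i.castSucc
    let a := z (Fin.last N) - (x (s N).1 - x (s N).2)
    -- Translating the class of `(s N).1` leaves the previous differences unchanged.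
    refine ⟨fun v ↦ if mergeMap s N v = mergeMap s N (s N).1 then x v + a else x v,
      funext <| Fin.lastCases ?_ fun i ↦ ?_⟩
    · simp only [Fin.val_last, if_true, if_neg (h N N.lt_succ_self).symm, a]
      abel
    · have hi : mergeMap s N (s i).1 = mergeMap s N (s i).2 :=
        mergeMap_eq_mono i.2 (mergeMap_succ_pair s i)
      have hxi : x (s i).1 - x (s i).2 = z i.castSucc := congrFun hx i
      simp only [Fin.val_castSucc, hi, ← hxi]
      split_ifs <;> abel

/-- The partitions produced by a merging strategy `σ`, which chooses the next pair to be merged as a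
function of the present partition. -/
noncomputable def strategyMap (σ : (V → V) → V × V) : ℕ → V → V
  | 0 => id
  | i + 1 => mergeStep (strategyMap σ i) (σ (strategyMap σ i))

/-- The pairs merged by the strategy `σ`. As there are finitely many strategies, one can sum over
them. -/
noncomputable def strategySeq (σ : (V → V) → V × V) (i : ℕ) : V × V :=
  σ (strategyMap σ i)

theorem mergeMap_strategySeq (σ : (V → V) → V × V) (i : ℕ) :
    mergeMap (strategySeq σ) i = strategyMap σ i := by
  induction i with
  | zero => rfl
  | succ i ih => rw [mergeMap, strategyMap, ih, strategySeq]

/-- The sequence `s` follows Kruskal's algorithm for `d`: each of its first `N` pairs minimises `d`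
among the pairs of points in different classes. -/
def IsGreedy {R : Type*} [LE R] (d : V → V → R) (s : ℕ → V × V) (N : ℕ) : Prop :=
  ∀ i < N, ∀ u v, mergeMap s i u ≠ mergeMap s i v → d (s i).1 (s i).2 ≤ d u v

theorem exists_isGreedy_strategySeq [Finite V] {R : Type*} [LinearOrder R] (d : V → V → R) {N : ℕ}
    (hN : Nat.card V = N + 1) :
    ∃ σ, IsMerging (strategySeq σ) N ∧ IsGreedy d (strategySeq σ) N := by
  have : Nonempty V := (Nat.card_pos_iff.1 (by lia)).1
  have hpick (f : V → V) : ∃ p : V × V, (∃ u v, f u ≠ f v) →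
      f p.1 ≠ f p.2 ∧ ∀ u v, f u ≠ f v → d p.1 p.2 ≤ d u v := by
    by_cases! h : ∃ u v, f u ≠ f v
    · obtain ⟨u, v, huv⟩ := h
      obtain ⟨p, hp, hmin⟩ := exists_min_image {p : V × V | f p.1 ≠ f p.2}
        (fun p ↦ d p.1 p.2) (toFinite _) ⟨(u, v), huv⟩
      exact ⟨p, fun _ ↦ ⟨hp, fun a b hab ↦ hmin (a, b) hab⟩⟩
    · exact ⟨Classical.arbitrary _, fun ⟨u, v, huv⟩ ↦ absurd (h u v) huv⟩
  choose σ hσ using hpick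
  let s := strategySeq σ
  have hpair {i : ℕ} (h : ∃ u v, mergeMap s i u ≠ mergeMap s i v) :
      mergeMap s i (s i).1 ≠ mergeMap s i (s i).2 ∧
        ∀ u v, mergeMap s i u ≠ mergeMap s i v → d (s i).1 (s i).2 ≤ d u v := by
    simp only [s, mergeMap_strategySeq] at h ⊢
    exact hσ _ h
  have hmerge : ∀ M ≤ N, IsMerging s M := by
    intro M hM
    induction M with
    | zero => exact fun i hi ↦ absurd hi i.not_lt_zero
    | succ M ih =>
      intro i hi
      obtain hi | rfl := Nat.lt_succ_iff_lt_or_eq.1 hi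
      · exact ih (by lia) i hi
      · exact (hpair ((ih (by lia)).exists_mergeMap_ne (by lia))).1
  exact ⟨σ, hmerge N le_rfl, fun i _ u v huv ↦ (hpair ⟨u, v, huv⟩).2 u v huv⟩

/-- The number of edges, with endpoints given by `p` and `q`, joining vertices which lie in the same
class after `i` steps. -/
noncomputable def mergedCount (p q : E → V) (s : ℕ → V × V) (i : ℕ) : ℕ :=
  {e | mergeMap s i (p e) = mergeMap s i (q e)}.ncard

/-- The set of edges whose endpoints come to lie in the same class in step `i`. -/
def stepEdges (p q : E → V) (s : ℕ → V × V) (i : ℕ) : Set E :=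
  {e | mergeMap s (i + 1) (p e) = mergeMap s (i + 1) (q e) ∧
    mergeMap s i (p e) ≠ mergeMap s i (q e)}

theorem mergedCount_succ [Finite E] (p q : E → V) (s : ℕ → V × V) (i : ℕ) :
    mergedCount p q s (i + 1) = mergedCount p q s i + (stepEdges p q s i).ncard := by
  have hsub : {e | mergeMap s i (p e) = mergeMap s i (q e)} ⊆
      {e | mergeMap s (i + 1) (p e) = mergeMap s (i + 1) (q e)} :=
    fun e he ↦ mergeMap_eq_mono i.le_succ he
  rw [mergedCount, mergedCount, ← ncard_sdiff_add_ncard_of_subset hsub, add_comm]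
  rfl

theorem IsMerging.existsUnique_mem_stepEdges [Finite V] {p q : E → V} {s : ℕ → V × V} {N : ℕ}
    (h : IsMerging s N) (hN : Nat.card V = N + 1) {e : E} (he : p e ≠ q e) :
    ∃! i : Fin N, e ∈ stepEdges p q s i := by
  obtain ⟨i, hi, hne, heq⟩ : ∃ i < N, mergeMap s i (p e) ≠ mergeMap s i (q e) ∧
      mergeMap s (i + 1) (p e) = mergeMap s (i + 1) (q e) := by
    by_contra! hcon
    have hne : ∀ i ≤ N, mergeMap s i (p e) ≠ mergeMap s i (q e) := fun i hi ↦ by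
      induction i with
      | zero => exact he
      | succ i ih => exact hcon i hi (ih (by lia))
    exact hne N le_rfl (h.mergeMap_eq hN _ _)
  refine ⟨⟨i, hi⟩, ⟨heq, hne⟩, fun j hj ↦ Fin.ext (le_antisymm ?_ ?_)⟩
  · by_contra! hij
    exact hj.2 (mergeMap_eq_mono hij heq)
  · by_contra! hij
    exact hne (mergeMap_eq_mono hij hj.1)

theorem IsMerging.prod_le_prod_pow_stepEdges [Finite V] [Fintype E] {M : Type*} [CommMonoid M]
    [PartialOrder M] [IsOrderedMonoid M] {p q : E → V} {s : ℕ → V × V} {N : ℕ} (h : IsMerging s N)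
    (hN : Nat.card V = N + 1) (hloop : ∀ e, p e ≠ q e) {f : V → V → M}
    (hf : ∀ i < N, ∀ u v, mergeMap s i u ≠ mergeMap s i v → f u v ≤ f (s i).1 (s i).2) :
    ∏ e, f (p e) (q e) ≤ ∏ i : Fin N, f (s i).1 (s i).2 ^ (stepEdges p q s i).ncard := by
  classical
  choose τ hτ hτ' using fun e ↦ h.existsUnique_mem_stepEdges hN (hloop e)
  have hfiber (i : Fin N) : stepEdges p q s i = ({e | τ e = i} : Finset E) := by
    ext e
    simp only [Finset.coe_filter, Finset.mem_univ, true_and, mem_ofPred_eq]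
    exact ⟨fun hi ↦ (hτ' e i hi).symm, fun hi ↦ hi ▸ hτ e⟩
  calc ∏ e, f (p e) (q e)
      ≤ ∏ e, f (s (τ e)).1 (s (τ e)).2 :=
        Finset.prod_le_prod' fun e _ ↦ hf _ (τ e).2 _ _ (hτ e).2
    _ = ∏ i : Fin N, ∏ e with τ e = i, f (s i).1 (s i).2 :=
        (Finset.prod_fiberwise' _ τ fun i : Fin N ↦ f (s i).1 (s i).2).symm
    _ = _ := by simp only [Finset.prod_const, hfiber, ncard_coe_finset]

end Merging

theorem IsMerging.lintegral_comp_differences {T : Type*} [AddCommGroup T] [TopologicalSpace T]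
    [IsTopologicalAddGroup T] [CompactSpace T] [SecondCountableTopology T] [MeasureSpace T]
    [BorelSpace T] [(volume : Measure T).IsAddHaarMeasure] {V : Type*} [Fintype V] {N : ℕ}
    (hN : Nat.card V = N + 1) {s : ℕ → V × V} (hs : IsMerging s N) {F : (Fin N → T) → ℝ≥0∞}
    (hF : Measurable F) :
    ∫⁻ x : V → T, F (fun i ↦ x (s i).1 - x (s i).2) = volume (univ : Set T) * ∫⁻ z, F z := by
  let D : (V → T) →+ (Fin N → T) :=
    { toFun x i := x (s i).1 - x (s i).2
      map_zero' := by simp [Pi.zero_def]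
      map_add' x y := by ext1 i; simp only [Pi.add_apply]; abel }
  have hcont : Continuous D :=
    show Continuous fun (x : V → T) (i : Fin N) ↦ x (s i).1 - x (s i).2 by fun_prop
  have (ι : Type _) [Fintype ι] : (volume : Measure (ι → T)).IsAddHaarMeasure :=
    inferInstanceAs (Measure.pi _).IsAddHaarMeasure
  have : (volume (univ : Set T) • (volume : Measure (Fin N → T))).IsAddHaarMeasure :=
    .smul _ (NeZero.ne _) (measure_ne_top _ _)
  have hD : MeasurePreserving D volume
      (volume (univ : Set T) • (volume : Measure (Fin N → T))) := by
    refine AddMonoidHom.measurePreserving hcont hs.surjective_differences ?_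
    rw [Measure.smul_apply, volume_pi, Measure.pi_univ, volume_pi, Measure.pi_univ,
      Finset.prod_const, Finset.prod_const, Finset.card_univ, ← Nat.card_eq_fintype_card, hN,
      Finset.card_fin, smul_eq_mul, pow_succ']
  rw [← smul_eq_mul, ← lintegral_smul_measure, ← hD.lintegral_comp hF]
  rfl

section Graph

variable {V E : Type*} {N : ℕ}

theorem IsMerging.differences_mem_orderedSet {x : V → Torus} {s : ℕ → V × V}
    (hs : IsMerging s N) (hg : IsGreedy (fun u v ↦ ‖x u - x v‖) s N) :
    (fun i : Fin N ↦ x (s i).1 - x (s i).2) ∈ orderedSet N Real.pi :=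
  ⟨fun i j hij ↦ hg i i.2 _ _ fun h ↦ hs j j.2 (mergeMap_eq_mono hij h),
    fun _ ↦ norm_torus_le_pi _⟩

/-- The bound on `∏ e, decay ε (x (p e) - x (q e))` given by a greedy merging sequence `s`, as a
function of the differences `x (s i).1 - x (s i).2`. -/
noncomputable def orderedDecay [Fintype E] (ε : ℝ) (p q : E → V) (s : ℕ → V × V) (N : ℕ) :
    (Fin N → Torus) → ℝ≥0∞ :=
  (orderedSet N Real.pi).indicator fun z ↦ ∏ i, decay ε (z i) ^ (stepEdges p q s i).ncard

theorem measurable_orderedDecay [Fintype E] (ε : ℝ) (p q : E → V) (s : ℕ → V × V) (N : ℕ) :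
    Measurable (orderedDecay ε p q s N) :=
  .indicator (by fun_prop) (measurableSet_orderedSet _ _)

theorem exists_prod_decay_le_orderedDecay [Finite V] [Fintype E] (hN : Nat.card V = N + 1)
    {p q : E → V} (hloop : ∀ e, p e ≠ q e) (ε : ℝ) (x : V → Torus) :
    ∃ σ, IsMerging (strategySeq σ) N ∧ ∏ e, decay ε (x (p e) - x (q e)) ≤
      orderedDecay ε p q (strategySeq σ) N
        fun i ↦ x (strategySeq σ i).1 - x (strategySeq σ i).2 := by
  obtain ⟨σ, hσ, hg⟩ := exists_isGreedy_strategySeq (fun u v ↦ ‖x u - x v‖) hN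
  refine ⟨σ, hσ, ?_⟩
  rw [orderedDecay, indicator_of_mem (hσ.differences_mem_orderedSet hg)]
  exact hσ.prod_le_prod_pow_stepEdges hN hloop (f := fun u v ↦ decay ε (x u - x v))
    fun i hi u v huv ↦ decay_le_decay (hg i hi u v huv)

theorem lintegral_orderedDecay_le [Fintype E] {ε : ℝ} (hε : 0 < ε) (hε1 : ε < 1) {p q : E → V}
    {s : ℕ → V × V} (hdeg : ∀ i ≤ N, mergedCount p q s i ≤ 2 * i) :
    ∫⁻ z, orderedDecay ε p q s N z ≤
      128 ^ N * 5 ^ (4 * N) *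
        logFactor ε ^ Nat.count (fun i ↦ mergedCount p q s (i + 1) = 2 * (i + 1)) N := by
  have hS (i : ℕ) (hi : i < N) : 4 * (i + 1) - 2 * mergedCount p q s (i + 1) +
      2 * (stepEdges p q s i).ncard = 4 * i - 2 * mergedCount p q s i + 4 := by
    have := hdeg i hi.le
    have := hdeg (i + 1) hi
    have := mergedCount_succ p q s i
    lia
  have hcount : Nat.count (fun i ↦ 4 * (i + 1) - 2 * mergedCount p q s (i + 1) = 0) N ≤
      Nat.count (fun i ↦ mergedCount p q s (i + 1) = 2 * (i + 1)) N := by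
    simp only [Nat.count_eq_card_filter_range]
    refine Finset.card_le_card fun i hi ↦ ?_
    simp only [Finset.mem_filter, Finset.mem_range] at hi ⊢
    exact ⟨hi.1, by have := hdeg (i + 1) hi.1; lia⟩
  have h5 : ENNReal.ofReal (Real.pi + ε) ≤ 5 := by
    rw [ENNReal.ofReal_le_ofNat]
    linarith [Real.pi_le_four]
  rw [orderedDecay, lintegral_indicator (measurableSet_orderedSet _ _)]
  grw [setLIntegral_orderedSet_le hε hε1 (S := fun i ↦ 4 * i - 2 * mergedCount p q s i)
    (by simp) hS Real.pi_nonneg Real.pi_le_four, pow_le_pow_right₀ (one_le_logFactor hε hε1) hcount,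
    h5, pow_le_pow_right₀ (by norm_num) (Nat.sub_le (4 * N) _)]
  exact (mul_right_comm _ _ _).le

theorem ne_of_mergedCount_zero_eq_zero [Finite E] {p q : E → V} {s : ℕ → V × V}
    (h : mergedCount p q s 0 = 0) (e : E) : p e ≠ q e := fun he ↦
  eq_empty_iff_forall_notMem.1 ((ncard_eq_zero (toFinite _)).1 h) e (congrArg _ he)

theorem lintegral_prod_decay_le [Fintype V] [Fintype E] (hN : Nat.card V = N + 1) {p q : E → V}
    {Z : ℕ}
    (hdeg : ∀ s, IsMerging s N → ∀ i ≤ N, mergedCount p q s i ≤ 2 * i)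
    (hZ : ∀ s, IsMerging s N →
      Nat.count (fun i ↦ mergedCount p q s (i + 1) = 2 * (i + 1)) N ≤ Z)
    {ε : ℝ} (hε : 0 < ε) (hε1 : ε < 1) :
    ∫⁻ x : V → Torus, ∏ e, decay ε (x (p e) - x (q e)) ≤
      Nat.card ((V → V) → V × V) * (volume (univ : Set Torus) * (128 ^ N * 5 ^ (4 * N))) *
        logFactor ε ^ Z := by
  classical
  obtain ⟨σ₀, hσ₀, -⟩ := exists_isGreedy_strategySeq (V := V) (fun _ _ ↦ (0 : ℕ)) hN
  have hloop := ne_of_mergedCount_zero_eq_zero (Nat.le_zero.1 (hdeg _ hσ₀ 0 N.zero_le))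
  let F (σ : (V → V) → V × V) (x : V → Torus) : ℝ≥0∞ := orderedDecay ε p q (strategySeq σ) N
    fun i ↦ x (strategySeq σ i).1 - x (strategySeq σ i).2
  calc ∫⁻ x : V → Torus, ∏ e, decay ε (x (p e) - x (q e))
      ≤ ∫⁻ x, ∑ σ with IsMerging (strategySeq σ) N, F σ x := by
        refine lintegral_mono fun x ↦ ?_
        obtain ⟨σ, hσ, hle⟩ := exists_prod_decay_le_orderedDecay hN hloop ε x
        exact hle.trans (Finset.single_le_sum (f := fun σ ↦ F σ x) (fun _ _ ↦ zero_le)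
          (Finset.mem_filter.2 ⟨Finset.mem_univ σ, hσ⟩))
    _ = ∑ σ with IsMerging (strategySeq σ) N, ∫⁻ x, F σ x :=
        lintegral_finsetSum _ fun σ _ ↦ (measurable_orderedDecay _ _ _ _ _).comp (by fun_prop)
    _ ≤ ∑ σ : (V → V) → V × V with IsMerging (strategySeq σ) N,
          volume (univ : Set Torus) * (128 ^ N * 5 ^ (4 * N) * logFactor ε ^ Z) := by
        refine Finset.sum_le_sum fun σ hσ ↦ ?_
        have hs := (Finset.mem_filter.1 hσ).2
        rw [hs.lintegral_comp_differences hN (measurable_orderedDecay _ _ _ _ _)]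
        grw [lintegral_orderedDecay_le hε hε1 (hdeg _ hs),
          pow_le_pow_right₀ (one_le_logFactor hε hε1) (hZ _ hs)]
    _ ≤ _ := by
        rw [Finset.sum_const, nsmul_eq_mul, Nat.card_eq_fintype_card]
        grw [Finset.card_filter_le, Finset.card_univ]
        exact le_of_eq (by ring)

end Graph

theorem mergeMap_shift_eq_iff {V W : Type*} {s : ℕ → V × V} {π : V → W}
    (hπ : ∀ u v, π u = π v ↔ mergeMap s 1 u = mergeMap s 1 v) {i : ℕ} {u v : V} :
    mergeMap (fun j ↦ (s (j + 1)).map π π) i (π u) =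
        mergeMap (fun j ↦ (s (j + 1)).map π π) i (π v) ↔
      mergeMap s (i + 1) u = mergeMap s (i + 1) v := by
  induction i generalizing u v with
  | zero => exact hπ u v
  | succ i ih => simp only [mergeMap_succ_eq_iff (i := i), mergeMap_succ_eq_iff (i := i + 1), ih,
      Prod.map_fst, Prod.map_snd]

theorem exists_eq_inl_of_map_eq_inl {α β α' β' : Type*} {f : α → α'} {g : β → β'} {x : α ⊕ β}
    {y : α'} (h : x.map f g = .inl y) : ∃ a, x = .inl a ∧ f a = y := by
  cases x with
  | inl a => exact ⟨a, rfl, Sum.inl_injective h⟩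
  | inr b => cases h

theorem exists_eq_inr_of_map_eq_inr {α β α' β' : Type*} {f : α → α'} {g : β → β'} {x : α ⊕ β}
    {y : β'} (h : x.map f g = .inr y) : ∃ b, x = .inr b ∧ g b = y := by
  cases x with
  | inl a => cases h
  | inr b => exact ⟨b, rfl, Sum.inr_injective h⟩

namespace FeynmanDiagram

variable {Γ : FeynmanDiagram}

section FibreEdges

variable {α : Type*}

/-- The internal edges whose endpoints have the same image under `f`, i.e. those inside the classes
of the partition encoded by `f`. -/
def fibreEdges (Γ : FeynmanDiagram) (f : Γ.I → α) : Set Γ.E :=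
  {e | ∃ u v, Γ.src e = .inl u ∧ Γ.tgt e = .inl v ∧ f u = f v}

theorem fibreEdges_congr {β : Type*} {f : Γ.I → α} {g : Γ.I → β}
    (h : ∀ u v, f u = f v ↔ g u = g v) : Γ.fibreEdges f = Γ.fibreEdges g := by
  simp only [fibreEdges, h]

/-- The source of an internal edge, as an internal vertex. -/
noncomputable def intSrc (Γ : FeynmanDiagram) (e : Γ.intEdges) : Γ.I := e.2.1.choose

/-- The target of an internal edge, as an internal vertex. -/
noncomputable def intTgt (Γ : FeynmanDiagram) (e : Γ.intEdges) : Γ.I := e.2.2.choose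

theorem src_eq_intSrc (e : Γ.intEdges) : Γ.src e = .inl (Γ.intSrc e) := e.2.1.choose_spec

theorem tgt_eq_intTgt (e : Γ.intEdges) : Γ.tgt e = .inl (Γ.intTgt e) := e.2.2.choose_spec

theorem mergedCount_eq_ncard_fibreEdges (s : ℕ → Γ.I × Γ.I) (i : ℕ) :
    mergedCount Γ.intSrc Γ.intTgt s i = (Γ.fibreEdges (mergeMap s i)).ncard := by
  rw [mergedCount, ← ncard_image_of_injective _ Subtype.val_injective]
  congr 1
  ext e
  constructor
  · rintro ⟨e, h, rfl⟩
    exact ⟨_, _, src_eq_intSrc e, tgt_eq_intTgt e, h⟩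
  · rintro ⟨u, v, hu, hv, h⟩
    let e' : Γ.intEdges := ⟨e, ⟨u, hu⟩, ⟨v, hv⟩⟩
    refine ⟨e', ?_, rfl⟩
    rwa [Sum.inl_injective (hu.symm.trans (src_eq_intSrc e')),
      Sum.inl_injective (hv.symm.trans (tgt_eq_intTgt e'))] at h

end FibreEdges

section Degree

theorem eq_of_reachable {α : Type*} {c : Γ.I ⊕ Γ.L → α}
    (hc : ∀ e, c (Γ.src e) = c (Γ.tgt e)) {a b : Γ.I ⊕ Γ.L} (h : Γ.graph.Reachable a b) :
    c a = c b := by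
  obtain ⟨w⟩ := h
  induction w with
  | nil => rfl
  | cons hadj _ ih =>
    rw [← ih]
    obtain ⟨-, ⟨e, rfl, rfl⟩ | ⟨e, rfl, rfl⟩⟩ := (SimpleGraph.fromRel_adj _ _ _).1 hadj
    · exact hc e
    · exact (hc e).symm

theorem reachable_src_tgt (e : Γ.E) : Γ.graph.Reachable (Γ.src e) (Γ.tgt e) := by
  by_cases h : Γ.src e = Γ.tgt e
  · rw [h]
  · exact SimpleGraph.Adj.reachable ((SimpleGraph.fromRel_adj _ _ _).2 ⟨h, .inl ⟨e, rfl, rfl⟩⟩)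

theorem Subdiagram.map_src_toDiagram (γ : Γ.Subdiagram) (e : γ.toDiagram.E) :
    (γ.toDiagram.src e).map Subtype.val Empty.elim = Γ.src e.1 :=
  (γ.src_mem e.1 e.2).choose_spec.2.symm

theorem Subdiagram.map_tgt_toDiagram (γ : Γ.Subdiagram) (e : γ.toDiagram.E) :
    (γ.toDiagram.tgt e).map Subtype.val Empty.elim = Γ.tgt e.1 :=
  (γ.tgt_mem e.1 e.2).choose_spec.2.symm

/-- The subdiagram consisting of all internal vertices and of the internal edges inside the classes
of the partition encoded by `f`. -/
def fibreSubdiagram {α : Type*} (Γ : FeynmanDiagram) (f : Γ.I → α) : Γ.Subdiagram where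
  verts := univ
  edges := Γ.fibreEdges f
  src_mem := fun _ ⟨u, _, hu, _, _⟩ ↦ ⟨u, mem_univ u, hu⟩
  tgt_mem := fun _ ⟨_, v, _, hv, _⟩ ↦ ⟨v, mem_univ v, hv⟩

theorem ncard_range_le_card_connectedComponent {α : Type*} (f : Γ.I → α) :
    (range f).ncard ≤ Nat.card (Γ.fibreSubdiagram f).toDiagram.graph.ConnectedComponent := by
  let Δ := (Γ.fibreSubdiagram f).toDiagram
  let c : Δ.I ⊕ Δ.L → range f := Sum.elim (fun v ↦ ⟨f v.1, mem_range_self _⟩) Empty.elim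
  have hc (e : Δ.E) : c (Δ.src e) = c (Δ.tgt e) := by
    obtain ⟨u, v, hu, hv, huv⟩ := e.2
    obtain ⟨u', hu', rfl⟩ :=
      exists_eq_inl_of_map_eq_inl ((Subdiagram.map_src_toDiagram _ e).trans hu)
    obtain ⟨v', hv', rfl⟩ :=
      exists_eq_inl_of_map_eq_inl ((Subdiagram.map_tgt_toDiagram _ e).trans hv)
    rw [show Δ.src e = .inl u' from hu', show Δ.tgt e = .inl v' from hv']
    exact Subtype.ext huv
  have : Finite Δ.graph.ConnectedComponent := Quot.finite _
  rw [← Nat.card_coe_set_eq]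
  refine Nat.card_le_card_of_surjective
    (Quot.lift c fun _ _ h ↦ eq_of_reachable hc h : Δ.graph.ConnectedComponent → range f) ?_
  rintro ⟨_, v, rfl⟩
  exact ⟨Δ.graph.connectedComponentMk (.inl ⟨v, mem_univ v⟩), rfl⟩

theorem degree_fibreSubdiagram_le {N : ℕ} {s : ℕ → Γ.I × Γ.I} (hs : IsMerging s N) :
    (Γ.fibreSubdiagram (mergeMap s N)).degree ≤
      4 * (N : ℤ) - 2 * (mergedCount Γ.intSrc Γ.intTgt s N : ℤ) := by
  have hrange := hs.ncard_range_mergeMap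
  have hcomp := ncard_range_le_card_connectedComponent (mergeMap s N)
  rw [Subdiagram.degree, mergedCount_eq_ncard_fibreEdges]
  simp only [fibreSubdiagram, ncard_univ] at hcomp ⊢
  lia

theorem Subdiagram.degree_nonneg_of_edges_eq_empty {γ : Γ.Subdiagram} (h : γ.edges = ∅) :
    0 ≤ γ.degree := by
  have hcomp : Nat.card γ.toDiagram.graph.ConnectedComponent ≤ γ.verts.ncard := by
    rw [← Nat.card_coe_set_eq]
    refine Nat.card_le_card_of_surjective
      (fun v : γ.verts ↦ γ.toDiagram.graph.connectedComponentMk (.inl v)) ?_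
    rintro ⟨v | l⟩
    · exact ⟨v, rfl⟩
    · exact nomatch l
  rw [degree, h, ncard_empty]
  lia

theorem IsPositive.degree_nonneg (h : Γ.IsPositive) (γ : Γ.Subdiagram) : 0 ≤ γ.degree := by
  obtain h0 | h0 := γ.edges.eq_empty_or_nonempty
  · exact Subdiagram.degree_nonneg_of_edges_eq_empty h0
  · exact (h γ h0).le

theorem mergedCount_le_of_degree_nonneg (h : ∀ γ : Γ.Subdiagram, 0 ≤ γ.degree) {N : ℕ}
    {s : ℕ → Γ.I × Γ.I} (hs : IsMerging s N) : mergedCount Γ.intSrc Γ.intTgt s N ≤ 2 * N := by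
  have := (h _).trans (degree_fibreSubdiagram_le hs)
  lia

theorem IsPositive.mergedCount_lt (h : Γ.IsPositive) {N : ℕ} {s : ℕ → Γ.I × Γ.I}
    (hs : IsMerging s (N + 1)) : mergedCount Γ.intSrc Γ.intTgt s (N + 1) < 2 * (N + 1) := by
  obtain h0 | h0 := (Γ.fibreEdges (mergeMap s (N + 1))).eq_empty_or_nonempty
  · rw [mergedCount_eq_ncard_fibreEdges, h0, ncard_empty]
    lia
  · have := (h (Γ.fibreSubdiagram _) h0).trans_le (degree_fibreSubdiagram_le hs)
    lia

end Degree

/-- Every edge is internal or a leg, i.e. it joins a leaf to an internal vertex, and every leaf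
carries exactly one leg. -/
structure HasLegs (Γ : FeynmanDiagram) : Prop where
  edge : ∀ e, e ∈ Γ.intEdges ∨ (∃ l v, Γ.src e = .inr l ∧ Γ.tgt e = .inl v) ∨
    ∃ v l, Γ.src e = .inl v ∧ Γ.tgt e = .inr l
  leaf : ∀ l, ∃! e, Γ.src e = .inr l ∨ Γ.tgt e = .inr l

section NestedBubble

/-- The projection of the internal vertices of `Γ` onto those of a contracted diagram. -/
def contractMk (Γ : FeynmanDiagram) (S : Set Γ.Subdiagram) : Γ.I → (Γ.contract S).I := Quot.mk _

theorem contractMk_singleton_eq_iff {γ : Γ.Subdiagram} {u v : Γ.I} :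
    Γ.contractMk {γ} u = Γ.contractMk {γ} v ↔ u = v ∨ (u ∈ γ.verts ∧ v ∈ γ.verts) := by
  classical
  constructor
  · let f (w : Γ.I) : Option Γ.I := if w ∈ γ.verts then none else some w
    have hf (a b : Γ.I) (hab : ∃ δ ∈ ({γ} : Set Γ.Subdiagram), a ∈ δ.verts ∧ b ∈ δ.verts) :
        f a = f b := by
      obtain ⟨_, rfl, ha, hb⟩ := hab
      simp only [f, if_pos ha, if_pos hb]
    intro h
    have hfuv : f u = f v := congrArg (Quot.lift f hf) h
    grind
  · rintro (rfl | ⟨hu, hv⟩)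
    · rfl
    · exact Quot.sound ⟨γ, rfl, hu, hv⟩

theorem image_fibreEdges_contract {α : Type*} {S : Set Γ.Subdiagram}
    (f : (Γ.contract S).I → α) : Subtype.val '' (Γ.contract S).fibreEdges f =
      {e ∈ Γ.fibreEdges (f ∘ Γ.contractMk S) | ∀ γ ∈ S, e ∉ γ.edges} := by
  ext e
  constructor
  · rintro ⟨⟨e, he⟩, ⟨u, v, hu, hv, huv⟩, rfl⟩
    obtain ⟨u, hu', rfl⟩ := exists_eq_inl_of_map_eq_inl hu
    obtain ⟨v, hv', rfl⟩ := exists_eq_inl_of_map_eq_inl hv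
    exact ⟨⟨u, v, hu', hv', huv⟩, he⟩
  · rintro ⟨⟨u, v, hu, hv, huv⟩, he⟩
    exact ⟨⟨e, he⟩, ⟨_, _, congrArg (Sum.map _ id) hu, congrArg (Sum.map _ id) hv, huv⟩, rfl⟩

theorem ncard_fibreEdges_contract_singleton {α : Type*} {γ : Γ.Subdiagram}
    {f : (Γ.contract {γ}).I → α} (hγ : γ.edges ⊆ Γ.fibreEdges (f ∘ Γ.contractMk {γ})) :
    ((Γ.contract {γ}).fibreEdges f).ncard + γ.edges.ncard =
      (Γ.fibreEdges (f ∘ Γ.contractMk {γ})).ncard := by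
  have himage : Subtype.val '' (Γ.contract {γ}).fibreEdges f =
      Γ.fibreEdges (f ∘ Γ.contractMk {γ}) \ γ.edges := by
    simp only [image_fibreEdges_contract, mem_singleton_iff, forall_eq]
    rfl
  have hcard : ((Γ.contract {γ}).fibreEdges f).ncard =
      (Γ.fibreEdges (f ∘ Γ.contractMk {γ}) \ γ.edges).ncard :=
    (ncard_image_of_injective _ Subtype.val_injective).symm.trans (congrArg ncard himage)
  rw [hcard, ncard_sdiff_add_ncard_of_subset hγ]

theorem HasLegs.contract (h : Γ.HasLegs) (S : Set Γ.Subdiagram) : (Γ.contract S).HasLegs where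
  edge := by
    rintro ⟨e, he⟩
    obtain ⟨⟨u, hu⟩, v, hv⟩ | ⟨l, v, hl, hv⟩ | ⟨v, l, hv, hl⟩ := h.edge e
    · exact .inl ⟨⟨_, congrArg (Sum.map _ id) hu⟩, ⟨_, congrArg (Sum.map _ id) hv⟩⟩
    · exact .inr (.inl ⟨l, _, congrArg (Sum.map _ id) hl, congrArg (Sum.map _ id) hv⟩)
    · exact .inr (.inr ⟨_, l, congrArg (Sum.map _ id) hv, congrArg (Sum.map _ id) hl⟩)
  leaf l := by
    obtain ⟨e, he, huniq⟩ := h.leaf l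
    have hnotMem : ∀ γ ∈ S, e ∉ γ.edges := fun γ _ hmem ↦ by
      obtain ⟨u, -, hu⟩ := γ.src_mem e hmem
      obtain ⟨v, -, hv⟩ := γ.tgt_mem e hmem
      simp [hu, hv] at he
    refine ⟨⟨e, hnotMem⟩, he.imp (congrArg (Sum.map _ id)) (congrArg (Sum.map _ id)), ?_⟩
    rintro ⟨e', he'⟩ hl
    refine Subtype.ext (huniq e' (hl.imp (fun h ↦ ?_) fun h ↦ ?_)) <;>
    · obtain ⟨l', hl', rfl⟩ := exists_eq_inr_of_map_eq_inr h
      exact hl'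

/-- The subdiagram of all edges joining the internal vertices `v` and `w`, in either direction. -/
def pairSubdiagram (Γ : FeynmanDiagram) (v w : Γ.I) : Γ.Subdiagram where
  verts := {v, w}
  edges := {e | (Γ.src e = .inl v ∧ Γ.tgt e = .inl w) ∨ (Γ.src e = .inl w ∧ Γ.tgt e = .inl v)}
  src_mem e he := he.elim (fun h ↦ ⟨v, by simp, h.1⟩) fun h ↦ ⟨w, by simp, h.1⟩
  tgt_mem e he := he.elim (fun h ↦ ⟨w, by simp, h.2⟩) fun h ↦ ⟨v, by simp, h.2⟩

theorem pairSubdiagram_full (v w : Γ.I) : (Γ.pairSubdiagram v w).Full := by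
  rintro e he e' hs ht
  rwa [pairSubdiagram, mem_ofPred_eq, hs, ht]

theorem contractMk_pairSubdiagram_eq_iff {s : ℕ → Γ.I × Γ.I} {u v : Γ.I} :
    Γ.contractMk {Γ.pairSubdiagram (s 0).1 (s 0).2} u =
        Γ.contractMk {Γ.pairSubdiagram (s 0).1 (s 0).2} v ↔
      mergeMap s 1 u = mergeMap s 1 v := by
  rw [contractMk_singleton_eq_iff, mergeMap_succ_eq_iff]
  simp only [pairSubdiagram, mergeMap, id, mem_insert_iff, mem_singleton_iff]
  grind

theorem pairSubdiagram_edges_eq_fibreEdges {s : ℕ → Γ.I × Γ.I}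
    (h : Γ.fibreEdges (mergeMap s 0) = ∅) :
    (Γ.pairSubdiagram (s 0).1 (s 0).2).edges = Γ.fibreEdges (mergeMap s 1) := by
  ext e
  constructor
  · rintro (⟨hs, ht⟩ | ⟨hs, ht⟩)
    · exact ⟨_, _, hs, ht, mergeMap_succ_pair s 0⟩
    · exact ⟨_, _, hs, ht, (mergeMap_succ_pair s 0).symm⟩
  · rintro ⟨u, v, hu, hv, huv⟩
    obtain huv | ⟨h1, h2⟩ | ⟨h1, h2⟩ := mergeMap_succ_eq_iff.1 huv
    · exact (eq_empty_iff_forall_notMem.1 h e ⟨u, v, hu, hv, huv⟩).elim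
    · exact .inl ⟨hu.trans (congrArg _ h1), hv.trans (congrArg _ h2)⟩
    · exact .inr ⟨hu.trans (congrArg _ h1), hv.trans (congrArg _ h2)⟩

theorem isCross_of_fibreEdges_eq_empty (hlegs : Γ.HasLegs) (hL : Nat.card Γ.L = 4)
    (hI : Nat.card Γ.I = 1) (h : Γ.fibreEdges (id : Γ.I → Γ.I) = ∅) : Γ.IsCross := by
  have hint : Γ.intEdges = ∅ := by
    rw [eq_empty_iff_forall_notMem] at h ⊢
    rintro e ⟨⟨u, hu⟩, v, hv⟩
    have := (Nat.card_eq_one_iff_unique.1 hI).1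
    exact h e ⟨u, v, hu, hv, Subsingleton.elim u v⟩
  exact ⟨hI, hL, hint, fun e ↦ (hlegs.edge e).resolve_left (by simp [hint]), hlegs.leaf⟩

theorem isNestedBubble_of_ncard_fibreEdges {N : ℕ} (hlegs : Γ.HasLegs) (hL : Nat.card Γ.L = 4)
    [hI : Nonempty Γ.I] {s : ℕ → Γ.I × Γ.I} (hs : IsMerging s N)
    (htop : ∀ u v, mergeMap s N u = mergeMap s N v)
    (hcount : ∀ i ≤ N, (Γ.fibreEdges (mergeMap s i)).ncard = 2 * i) : IsNestedBubble Γ := by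
  have h0 : Γ.fibreEdges (mergeMap s 0) = ∅ := (ncard_eq_zero (toFinite _)).1 (hcount 0 N.zero_le)
  induction N generalizing Γ with
  | zero =>
    exact .cross Γ (isCross_of_fibreEdges_eq_empty hlegs hL
      (Nat.card_eq_one_iff_unique.2 ⟨⟨htop⟩, hI⟩) h0)
  | succ N ih =>
    let γ := Γ.pairSubdiagram (s 0).1 (s 0).2
    have hedges : γ.edges = Γ.fibreEdges (mergeMap s 1) := pairSubdiagram_edges_eq_fibreEdges h0
    have hbubble : γ.IsBubble :=
      ⟨_, _, hs 0 N.succ_pos, rfl, hedges ▸ hcount 1 (by lia), fun e he ↦ he⟩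
    refine .bubble Γ γ hbubble (pairSubdiagram_full _ _) ?_
    let π := Γ.contractMk {γ}
    let s' (j : ℕ) := (s (j + 1)).map π π
    have hπ {i : ℕ} {u v : Γ.I} : mergeMap s' i (π u) = mergeMap s' i (π v) ↔
        mergeMap s (i + 1) u = mergeMap s (i + 1) v :=
      mergeMap_shift_eq_iff fun _ _ ↦ contractMk_pairSubdiagram_eq_iff
    have hcount' : ∀ i ≤ N, ((Γ.contract {γ}).fibreEdges (mergeMap s' i)).ncard = 2 * i := by
      intro i hi
      have hsub : γ.edges ⊆ Γ.fibreEdges (mergeMap s (i + 1)) := by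
        rintro e he
        obtain ⟨u, v, hu, hv, huv⟩ := hedges ▸ he
        exact ⟨u, v, hu, hv, mergeMap_eq_mono (by lia) huv⟩
      have hfibre : Γ.fibreEdges (mergeMap s' i ∘ π) = Γ.fibreEdges (mergeMap s (i + 1)) :=
        fibreEdges_congr fun _ _ ↦ hπ
      have hcard := ncard_fibreEdges_contract_singleton (hfibre ▸ hsub)
      rw [hfibre, hcount _ (by lia), hedges, hcount 1 (by lia)] at hcard
      lia
    exact ih (hlegs.contract _) hL (hI := hI.map π)
      (fun i hi h ↦ hs (i + 1) (by lia) (hπ.1 h))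
      (fun a b ↦ Quot.induction_on₂ a b fun u v ↦ hπ.2 (htop u v)) hcount'
      ((ncard_eq_zero (toFinite _)).1 (hcount' 0 N.zero_le))

end NestedBubble

end FeynmanDiagram

section PiProd

variable {α : Type*} [MeasureSpace α] [SigmaFinite (volume : Measure α)]

theorem lintegral_fin_prod {n : ℕ} {f : Fin n → α → ℝ≥0∞} (hf : ∀ i, Measurable (f i)) :
    ∫⁻ x : Fin n → α, ∏ i, f i (x i) = ∏ i, ∫⁻ t, f i t := by
  induction n with
  | zero => simp [volume_pi]
  | succ n ih =>
    have hpres := volume_preserving_piFinSuccAbove (fun _ : Fin (n + 1) ↦ α) 0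
    rw [← hpres.symm.lintegral_comp (by fun_prop), Measure.volume_eq_prod, Fin.prod_univ_succ,
      ← ih fun i ↦ hf i.succ, ← lintegral_prod_mul (hf 0).aemeasurable
        (Measurable.aemeasurable (by fun_prop (disch := exact hf _)))]
    simp only [Fin.prod_univ_succ, MeasurableEquiv.piFinSuccAbove_symm_apply,
      Fin.insertNthEquiv_zero, Fin.consEquiv_apply, Fin.cons_zero, Fin.cons_succ]

theorem lintegral_fintype_prod {ι : Type*} [Fintype ι] {f : ι → α → ℝ≥0∞}
    (hf : ∀ i, Measurable (f i)) :
    ∫⁻ x : ι → α, ∏ i, f i (x i) = ∏ i, ∫⁻ t, f i t := by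
  let e := (Fintype.equivFin ι).symm
  rw [← (volume_measurePreserving_piCongrLeft (fun _ : ι ↦ α) e).lintegral_comp (by fun_prop),
    ← e.prod_comp, ← lintegral_fin_prod fun i ↦ hf (e i)]
  refine lintegral_congr fun x ↦ ?_
  rw [← e.prod_comp]
  simp only [MeasurableEquiv.piCongrLeft_apply_apply e (β := fun _ ↦ α)]

end PiProd

namespace FeynmanDiagram

variable {Γ : FeynmanDiagram} {ρ : EuclideanSpace ℝ (Fin 4) → ℝ} {ε : ℝ}

section Valuation

theorem val_eq_integral (h : ∀ v, ∃ l, Γ.graph.Reachable (.inl v) (.inr l))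
    (x : Γ.L → Torus) : Γ.val ρ ε x = ∫ y : Γ.I → Torus,
      ∏ e, greenMoll ρ ε (Sum.elim y x (Γ.tgt e) - Sum.elim y x (Γ.src e)) := by
  have hfree (v : Γ.I) : ¬ Γ.Pinned v := fun hv ↦ (h v).elim hv.1
  let f : Γ.Free ≃ Γ.I := Equiv.subtypeUnivEquiv hfree
  rw [val, ← (volume_measurePreserving_piCongrLeft (fun _ : Γ.I ↦ Torus) f).integral_comp']
  have hpos (y : Γ.Free → Torus) : Γ.position y x =
      Sum.elim (MeasurableEquiv.piCongrLeft (fun _ : Γ.I ↦ Torus) f y) x := by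
    ext1 (v | l)
    · simp only [position, dif_neg (hfree v)]
      exact (MeasurableEquiv.piCongrLeft_apply_apply f (β := fun _ ↦ Torus) y ⟨v, hfree v⟩).symm
    · rfl
  simp only [hpos]

theorem reachable_contract (S : Set Γ.Subdiagram) {a b : Γ.I ⊕ Γ.L}
    (h : Γ.graph.Reachable a b) : (Γ.contract S).graph.Reachable
      (a.map (Γ.contractMk S) id) (b.map (Γ.contractMk S) id) := by
  refine SimpleGraph.ConnectedComponent.exact (eq_of_reachable
    (c := fun w ↦ (Γ.contract S).graph.connectedComponentMk (w.map (Γ.contractMk S) id))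
    (fun e ↦ ?_) h)
  by_cases he : ∀ γ ∈ S, e ∉ γ.edges
  · exact SimpleGraph.ConnectedComponent.sound (reachable_src_tgt (Γ := Γ.contract S) ⟨e, he⟩)
  · push Not at he
    obtain ⟨γ, hγ, he⟩ := he
    obtain ⟨u, hu, hsrc⟩ := γ.src_mem e he
    obtain ⟨v, hv, htgt⟩ := γ.tgt_mem e he
    have huv : Γ.contractMk S u = Γ.contractMk S v := Quot.sound ⟨γ, hγ, hu, hv⟩
    rw [hsrc, htgt]
    exact congrArg (fun w ↦ (Γ.contract S).graph.connectedComponentMk (.inl w)) huv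

theorem contractMk_empty_bijective : Function.Bijective (Γ.contractMk ∅) := by
  refine ⟨fun a b hab ↦ ?_, Quot.mk_surjective⟩
  exact congrArg (Quot.lift id fun u v ⟨_, hγ, _⟩ ↦ (notMem_empty _ hγ).elim) hab

theorem val_contract_empty (h : ∀ v, ∃ l, Γ.graph.Reachable (.inl v) (.inr l))
    (x : Γ.L → Torus) : (Γ.contract ∅).val ρ ε x = Γ.val ρ ε x := by
  have h' (v : (Γ.contract ∅).I) : ∃ l, (Γ.contract ∅).graph.Reachable (.inl v) (.inr l) := by
    obtain ⟨u, rfl⟩ := contractMk_empty_bijective.2 v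
    exact (h u).imp fun _ ↦ reachable_contract ∅
  let f : Γ.I ≃ (Γ.contract ∅).I := .ofBijective _ contractMk_empty_bijective
  let g : (Γ.contract ∅).E ≃ Γ.E := Equiv.subtypeUnivEquiv fun _ _ hγ ↦ (notMem_empty _ hγ).elim
  let F := MeasurableEquiv.piCongrLeft (fun _ : (Γ.contract ∅).I ↦ Torus) f
  have hpos (y : Γ.I → Torus) (w : Γ.I ⊕ Γ.L) :
      Sum.elim (F y) x (w.map (Γ.contractMk ∅) id) = Sum.elim y x w := by
    obtain v | l := w
    · exact MeasurableEquiv.piCongrLeft_apply_apply f (β := fun _ ↦ Torus) y v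
    · rfl
  refine (val_eq_integral h' x).trans (.trans ?_ (val_eq_integral h x).symm)
  rw [← (volume_measurePreserving_piCongrLeft (fun _ : (Γ.contract ∅).I ↦ Torus) f).integral_comp']
  refine integral_congr_ae (.of_forall fun y ↦ ?_)
  refine Fintype.prod_equiv g _ _ fun e ↦ ?_
  rw [← hpos y, ← hpos y]
  rfl

theorem IsPositive.forests_eq (h : Γ.IsPositive) : Γ.forests = {∅} := by
  ext F
  simp only [forests, Finset.mem_filter, Finset.mem_univ, true_and, Finset.mem_singleton]
  constructor
  · rintro ⟨hF, -⟩
    exact Finset.eq_empty_of_forall_notMem fun γ hγ ↦ (hF γ hγ).2.2.not_ge (h.degree_nonneg γ)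
  · rintro rfl
    simp

theorem IsPositive.renVal_eq (hpos : Γ.IsPositive)
    (h : ∀ v, ∃ l, Γ.graph.Reachable (.inl v) (.inr l)) (x : Γ.L → Torus) :
    Γ.renVal ρ ε x = Γ.val ρ ε x := by
  have hroots : roots (∅ : Finset Γ.Subdiagram) = ∅ :=
    eq_empty_of_forall_notMem fun γ hγ ↦ Finset.notMem_empty γ hγ.1
  rw [renVal, hpos.forests_eq, Finset.sum_singleton, valExtract, hroots, val_contract_empty h,
    Finset.prod_empty, Finset.card_empty, pow_zero, one_mul, mul_one]

end Valuation

section Bound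

theorem HasLegs.exists_bijective (h : Γ.HasLegs) : ∃ (leg : Γ.L → Γ.E) (att : Γ.L → Γ.I),
    (∀ l, (Γ.src (leg l) = .inr l ∧ Γ.tgt (leg l) = .inl (att l)) ∨
      (Γ.src (leg l) = .inl (att l) ∧ Γ.tgt (leg l) = .inr l)) ∧
    Function.Bijective (Sum.elim leg (Subtype.val : Γ.intEdges → Γ.E)) := by
  have hex (l : Γ.L) : ∃ e v, (Γ.src e = .inr l ∧ Γ.tgt e = .inl v) ∨
      (Γ.src e = .inl v ∧ Γ.tgt e = .inr l) := by
    obtain ⟨e, he, -⟩ := h.leaf l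
    obtain ⟨⟨u, hu⟩, v, hv⟩ | ⟨l', v, hl, hv⟩ | ⟨v, l', hv, hl⟩ := h.edge e
    · simp [hu, hv] at he
    · exact ⟨e, v, .inl ⟨by simpa [hl, hv] using he, hv⟩⟩
    · exact ⟨e, v, .inr ⟨hv, by simpa [hl, hv] using he⟩⟩
  choose leg att hleg using hex
  have hnotMem (l : Γ.L) : leg l ∉ Γ.intEdges := by
    rintro ⟨⟨u, hu⟩, v, hv⟩
    simpa [hu, hv] using hleg l
  have hinj : Function.Injective leg := fun l l' hll ↦ by
    have h1 := hleg l
    have h2 := hleg l'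
    grind
  refine ⟨leg, att, hleg, hinj.sumElim Subtype.val_injective
    fun l e hle ↦ hnotMem l (hle ▸ e.2), fun e ↦ ?_⟩
  have hleaf (l : Γ.L) (hl : Γ.src e = .inr l ∨ Γ.tgt e = .inr l) : leg l = e :=
    (h.leaf l).unique ((hleg l).imp And.left And.right) hl
  obtain he | ⟨l, -, hl, -⟩ | ⟨-, l, -, hl⟩ := h.edge e
  · exact ⟨.inr ⟨e, he⟩, rfl⟩
  · exact ⟨.inl l, hleaf l (.inl hl)⟩
  · exact ⟨.inl l, hleaf l (.inr hl)⟩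

theorem HasLegs.card_edges (h : Γ.HasLegs) : Nat.card Γ.E = Nat.card Γ.L + Γ.numIntEdges := by
  obtain ⟨leg, att, -, hb⟩ := h.exists_bijective
  rw [← Nat.card_eq_of_bijective _ hb, Nat.card_sum, numIntEdges, Nat.card_coe_set_eq]

open Classical in
theorem HasLegs.exists_prod_eq (h : Γ.HasLegs) {α M : Type*} [CommMonoid M] {f : α → α → M}
    (hf : ∀ a b, f a b = f b a) : ∃ att : Γ.L → Γ.I, ∀ (y : Γ.I → α) (x : Γ.L → α),
      ∏ e, f (Sum.elim y x (Γ.tgt e)) (Sum.elim y x (Γ.src e)) =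
        (∏ l, f (x l) (y (att l))) * ∏ e, f (y (Γ.intSrc e)) (y (Γ.intTgt e)) := by
  obtain ⟨leg, att, hleg, hb⟩ := h.exists_bijective
  refine ⟨att, fun y x ↦ ?_⟩
  rw [← hb.prod_comp, Fintype.prod_sum_type]
  congr 1
  · refine Finset.prod_congr rfl fun l _ ↦ ?_
    obtain ⟨h1, h2⟩ | ⟨h1, h2⟩ := hleg l
    · simp only [Sum.elim_inl, Sum.elim_inr, h1, h2, hf (x l)]
    · simp only [Sum.elim_inl, Sum.elim_inr, h1, h2]
  · refine Finset.prod_congr rfl fun e _ ↦ ?_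
    simp only [Sum.elim_inl, Sum.elim_inr, src_eq_intSrc, tgt_eq_intTgt]
    exact hf _ _

open Classical in
theorem HasLegs.lintegral_prod_decay_le (h : Γ.HasLegs) (hε : 0 < ε) (hε1 : ε < 1) :
    ∫⁻ x : Γ.L → Torus, ∫⁻ y : Γ.I → Torus,
        ∏ e, decay ε (Sum.elim y x (Γ.tgt e) - Sum.elim y x (Γ.src e)) ≤
      3200 ^ Nat.card Γ.L * ∫⁻ y : Γ.I → Torus,
        ∏ e, decay ε (y (Γ.intSrc e) - y (Γ.intTgt e)) := by
  obtain ⟨att, hatt⟩ := h.exists_prod_eq (f := fun a b ↦ decay ε (a - b)) (decay_sub_comm ε)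
  have hlegs (y : Γ.I → Torus) :
      ∫⁻ x : Γ.L → Torus, ∏ l, decay ε (x l - y (att l)) ≤ 3200 ^ Nat.card Γ.L := by
    rw [lintegral_fintype_prod (f := fun l t ↦ decay ε (t - y (att l))) (by fun_prop),
      Nat.card_eq_fintype_card, Fintype.card, ← Finset.prod_const]
    gcongr with l
    rw [lintegral_sub_right_eq_self (decay ε)]
    exact lintegral_decay_le hε hε1
  simp only [hatt]
  rw [lintegral_lintegral_swap (by fun_prop), ← lintegral_const_mul _ (by fun_prop)]
  gcongr with y
  rw [lintegral_mul_const _ (by fun_prop)]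
  gcongr
  exact hlegs y

theorem enorm_finsetProd {ι : Type*} (s : Finset ι) (f : ι → ℝ) :
    ‖∏ i ∈ s, f i‖ₑ = ∏ i ∈ s, ‖f i‖ₑ := by
  simp only [enorm_eq_nnnorm, nnnorm_prod, ENNReal.ofNNReal_finsetProd]

theorem enorm_val_le {A : ℝ≥0} (hA : ∀ x, ‖greenMoll ρ ε x‖ₑ ≤ A * decay ε x)
    (h : ∀ v, ∃ l, Γ.graph.Reachable (.inl v) (.inr l)) (x : Γ.L → Torus) :
    ‖Γ.val ρ ε x‖ₑ ≤ A ^ Nat.card Γ.E * ∫⁻ y : Γ.I → Torus,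
      ∏ e, decay ε (Sum.elim y x (Γ.tgt e) - Sum.elim y x (Γ.src e)) := by
  rw [val_eq_integral h, ← lintegral_const_mul' _ _ (by finiteness)]
  refine (enorm_integral_le_lintegral_enorm _).trans (lintegral_mono fun y ↦ ?_)
  rw [enorm_finsetProd, Nat.card_eq_fintype_card, Fintype.card, ← Finset.prod_const,
    ← Finset.prod_mul_distrib]
  exact Finset.prod_le_prod' fun e _ ↦ hA _

open Classical in
theorem HasLegs.enorm_valTest_le (hlegs : Γ.HasLegs) {A : ℝ≥0}
    (hA : ∀ x, ‖greenMoll ρ ε x‖ₑ ≤ A * decay ε x)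
    (h : ∀ v, ∃ l, Γ.graph.Reachable (.inl v) (.inr l)) (hε : 0 < ε) (hε1 : ε < 1)
    {φ : (Γ.L → Torus) → ℝ} (hφ : MemLp φ ⊤) :
    ‖Γ.valTest ρ ε φ‖ₑ ≤ eLpNorm φ ⊤ volume * (A ^ Nat.card Γ.E *
      (3200 ^ Nat.card Γ.L * ∫⁻ y : Γ.I → Torus,
        ∏ e, decay ε (y (Γ.intSrc e) - y (Γ.intTgt e)))) := by
  grw [← hlegs.lintegral_prod_decay_le hε hε1]
  rw [← lintegral_const_mul' _ _ (by finiteness), ← lintegral_const_mul' _ _ hφ.2.ne]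
  refine (enorm_integral_le_lintegral_enorm _).trans (lintegral_mono_ae ?_)
  filter_upwards [ae_le_eLpNormEssSup (f := φ) (μ := volume)] with x hx
  rw [enorm_mul, mul_comm, eLpNorm_exponent_top]
  grw [hx, enorm_val_le hA h]

theorem exists_abs_valTest_le (hρ : MemLp ρ ⊤) (hsupp : HasCompactSupport ρ) (N d m : ℕ) :
    ∃ C : ℝ≥0, ∀ Γ : FeynmanDiagram, Γ.HasLegs →
      (∀ v, ∃ l, Γ.graph.Reachable (.inl v) (.inr l)) →
      Nat.card Γ.I = N + 1 → Nat.card Γ.L = d → Γ.numIntEdges = m → ∀ Z : ℕ,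
      (∀ s, IsMerging s N → ∀ i ≤ N, mergedCount Γ.intSrc Γ.intTgt s i ≤ 2 * i) →
      (∀ s, IsMerging s N →
        Nat.count (fun i ↦ mergedCount Γ.intSrc Γ.intTgt s (i + 1) = 2 * (i + 1)) N ≤ Z) →
      ∀ φ : (Γ.L → Torus) → ℝ, MemLp φ ⊤ → ∀ ε : ℝ, 0 < ε → ε < 1 →
        |Γ.valTest ρ ε φ| ≤ C * lpNorm φ ⊤ volume * (1 + Real.log (1 / ε)) ^ Z := by
  classical
  obtain ⟨A, hA⟩ := exists_enorm_greenMoll_le hρ hsupp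
  let K : ℝ≥0∞ := A ^ (d + m) * (3200 ^ d * ((((N + 1) * (N + 1)) ^ (N + 1) ^ (N + 1) : ℕ) *
    (volume (univ : Set Torus) * (128 ^ N * 5 ^ (4 * N)))))
  have hK : K ≠ ⊤ := by finiteness
  refine ⟨K.toNNReal, fun Γ hlegs hreach hI hL hm Z hdeg hZ φ hφ ε hε hε1 ↦ ?_⟩
  have hcard : Nat.card ((Γ.I → Γ.I) → Γ.I × Γ.I) = ((N + 1) * (N + 1)) ^ (N + 1) ^ (N + 1) := by
    rw [Nat.card_fun, Nat.card_fun, Nat.card_prod, hI]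
  have hlog : 0 ≤ 1 + Real.log (1 / ε) := by
    linarith [Real.log_nonneg ((one_le_div hε).2 hε1.le)]
  have hbound : ‖Γ.valTest ρ ε φ‖ₑ ≤ K * eLpNorm φ ⊤ volume * logFactor ε ^ Z := by
    grw [hlegs.enorm_valTest_le (hA ε hε hε1) hreach hε hε1 hφ,
      lintegral_prod_decay_le hI hdeg hZ hε hε1, hlegs.card_edges, hL, hm, hcard]
    exact le_of_eq (by ring)
  have := ENNReal.toReal_mono (ENNReal.mul_ne_top (ENNReal.mul_ne_top hK hφ.2.ne)
    (ENNReal.pow_ne_top ENNReal.ofReal_ne_top)) hbound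
  rwa [toReal_enorm, ENNReal.toReal_mul, ENNReal.toReal_mul, toReal_eLpNorm hφ.1,
    ENNReal.toReal_pow, ENNReal.toReal_ofReal hlog] at this

end Bound
end FeynmanDiagram

section Count

variable {e : ℕ → ℕ} {N : ℕ}

theorem two_mul_count_le (hmono : Monotone e) (he : ∀ i ≤ N, e i ≤ 2 * i) :
    2 * Nat.count (fun i ↦ e (i + 1) = 2 * (i + 1)) N ≤ e N := by
  induction N with
  | zero => simp
  | succ N ih =>
    have hprev := ih fun i hi ↦ he i (by lia)
    have hstep := hmono N.le_succ
    have hcount := Nat.count_le (p := fun i ↦ e (i + 1) = 2 * (i + 1)) (n := N)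
    rw [Nat.count_succ]
    split_ifs <;> lia

theorem eq_two_mul_of_two_mul_count_eq (hmono : Monotone e) (he : ∀ i ≤ N, e i ≤ 2 * i)
    (hlast : ∀ i, i + 1 = N → e i < e N)
    (hcount : 2 * Nat.count (fun i ↦ e (i + 1) = 2 * (i + 1)) N = e N) :
    ∀ i ≤ N, e i = 2 * i := by
  have hN : Nat.count (fun i ↦ e (i + 1) = 2 * (i + 1)) N = N := by
    cases N with
    | zero => simp
    | succ N =>
      have hprev := two_mul_count_le hmono fun i (hi : i ≤ N) ↦ he i (by lia)
      have hlt := hlast N rfl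
      have hle := he (N + 1) le_rfl
      rw [Nat.count_succ] at hcount ⊢
      split_ifs at hcount ⊢ <;> lia
  intro i hi
  cases i with
  | zero => exact Nat.le_zero.1 (he 0 hi)
  | succ i => exact Nat.count_iff_forall.1 hN i hi

end Count

theorem mergedCount_mono {V E : Type*} [Finite E] (p q : E → V) (s : ℕ → V × V) :
    Monotone (mergedCount p q s) :=
  monotone_nat_of_le_succ fun i ↦ by
    rw [mergedCount_succ]
    lia

namespace FeynmanDiagram

variable {Γ : FeynmanDiagram} {N : ℕ} {s : ℕ → Γ.I × Γ.I}

theorem mergedCount_eq_numIntEdges (hI : Nat.card Γ.I = N + 1) (hs : IsMerging s N) :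
    mergedCount Γ.intSrc Γ.intTgt s N = Γ.numIntEdges := by
  have huniv : {e | mergeMap s N (Γ.intSrc e) = mergeMap s N (Γ.intTgt e)} = univ :=
    eq_univ_of_forall fun e ↦ hs.mergeMap_eq hI _ _
  rw [mergedCount, huniv, ncard_univ, numIntEdges, Nat.card_coe_set_eq]

theorem HasLegs.eq_of_connected (h : Γ.HasLegs) (hc : Γ.Connected) {α : Type*} {f : Γ.I → α}
    (hf : ∀ e, f (Γ.intSrc e) = f (Γ.intTgt e)) (u v : Γ.I) : f u = f v := by
  obtain ⟨leg, att, hleg, hb⟩ := h.exists_bijective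
  refine eq_of_reachable (c := Sum.elim f fun l ↦ f (att l)) (fun e ↦ ?_)
    (hc.preconnected (.inl u) (.inl v))
  obtain ⟨l | e, rfl⟩ := hb.surjective e
  · obtain ⟨h1, h2⟩ | ⟨h1, h2⟩ := hleg l <;> simp only [Sum.elim_inl, h1, h2, Sum.elim_inr]
  · rw [Sum.elim_inr, src_eq_intSrc, tgt_eq_intTgt]
    exact hf e

theorem HasLegs.mergedCount_lt_of_connected (h : Γ.HasLegs) (hc : Γ.Connected)
    (hI : Nat.card Γ.I = N + 1) (hs : IsMerging s N) {i : ℕ} (hi : i + 1 = N) :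
    mergedCount Γ.intSrc Γ.intTgt s i < mergedCount Γ.intSrc Γ.intTgt s N := by
  by_contra! hle
  rw [mergedCount_eq_numIntEdges hI hs, numIntEdges, ← Nat.card_coe_set_eq, ← ncard_univ] at hle
  have huniv := eq_of_subset_of_ncard_le (subset_univ _) hle
  exact hs i (by lia) (h.eq_of_connected hc (eq_univ_iff_forall.1 huniv) _ _)

theorem HasLegs.two_mul_count_lt (h : Γ.HasLegs) (hc : Γ.Connected)
    (hdeg : ∀ γ : Γ.Subdiagram, 0 ≤ γ.degree)
    (hvalence : 4 * Nat.card Γ.I = Nat.card Γ.L + 2 * Γ.numIntEdges)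
    (hnb : Nat.card Γ.L = 4 → ¬ Γ.IsNestedBubble) (hI : Nat.card Γ.I = N + 1)
    (hs : IsMerging s N) :
    2 * Nat.count (fun i ↦ mergedCount Γ.intSrc Γ.intTgt s (i + 1) = 2 * (i + 1)) N <
      Γ.numIntEdges := by
  have hmono := mergedCount_mono Γ.intSrc Γ.intTgt s
  have hle : ∀ i ≤ N, mergedCount Γ.intSrc Γ.intTgt s i ≤ 2 * i := fun i hi ↦
    mergedCount_le_of_degree_nonneg hdeg (hs.mono hi)
  have hN := mergedCount_eq_numIntEdges hI hs
  refine (hN ▸ two_mul_count_le hmono hle).lt_of_ne fun heq ↦ ?_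
  have hall := eq_two_mul_of_two_mul_count_eq hmono hle
    (fun i ↦ h.mergedCount_lt_of_connected hc hI hs) (heq.trans hN.symm)
  have hL : Nat.card Γ.L = 4 := by
    have := hall N le_rfl
    lia
  have : Nonempty Γ.I := (Nat.card_pos_iff.1 (by lia)).1
  exact hnb hL (isNestedBubble_of_ncard_fibreEdges h hL hs (hs.mergeMap_eq hI) fun i hi ↦
    (mergedCount_eq_ncard_fibreEdges s i).symm.trans (hall i hi))

end FeynmanDiagram

section Paired

variable {k : ℕ} {n : Fin k → ℕ} {κ : Pairing n}

theorem paired_tgt_last (i : Fin k) : (paired n κ).tgt ⟨i, Fin.last _⟩ = .inr (i, true) := by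
  simp only [paired, Fin.lastCases_last]

theorem paired_tgt_castSucc (i : Fin k) (j : Fin (n i)) :
    (paired n κ).tgt ⟨i, j.castSucc⟩ = .inl (Quot.mk _ ⟨i, j⟩) := by
  simp only [paired, Fin.lastCases_castSucc]

theorem paired_src_eq_inr_iff {e : (paired n κ).E} {l : Fin k × Bool} :
    (paired n κ).src e = .inr l ↔ e = ⟨l.1, 0⟩ ∧ l.2 = false := by
  refine ⟨fun h ↦ ?_, ?_⟩
  · obtain ⟨i, j⟩ := e
    cases j using Fin.cases with
    | zero =>
      obtain rfl : (i, false) = l := Sum.inr_injective h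
      exact ⟨rfl, rfl⟩
    | succ j => cases h
  · obtain ⟨i, b⟩ := l
    rintro ⟨rfl, rfl⟩
    rfl

theorem paired_tgt_eq_inr_iff {e : (paired n κ).E} {l : Fin k × Bool} :
    (paired n κ).tgt e = .inr l ↔ e = ⟨l.1, Fin.last _⟩ ∧ l.2 = true := by
  refine ⟨fun h ↦ ?_, ?_⟩
  · obtain ⟨i, j⟩ := e
    cases j using Fin.lastCases with
    | last =>
      obtain rfl : (i, true) = l := Sum.inr_injective ((paired_tgt_last i).symm.trans h)
      exact ⟨rfl, rfl⟩
    | cast j => cases (paired_tgt_castSucc i j).symm.trans h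
  · obtain ⟨i, b⟩ := l
    rintro ⟨rfl, rfl⟩
    exact paired_tgt_last i

theorem paired_hasLegs (hn : ∀ i, 1 ≤ n i) : (paired n κ).HasLegs where
  edge e := by
    cases hs : (paired n κ).src e with
    | inl v =>
      cases ht : (paired n κ).tgt e with
      | inl w => exact .inl ⟨⟨v, hs⟩, w, ht⟩
      | inr l => exact .inr (.inr ⟨v, l, rfl, rfl⟩)
    | inr l =>
      cases ht : (paired n κ).tgt e with
      | inl w => exact .inr (.inl ⟨l, w, rfl, rfl⟩)
      | inr l' =>
        obtain ⟨rfl, -⟩ := paired_src_eq_inr_iff.1 hs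
        have hmem : (⟨l.1, 0⟩ : (paired n κ).E) ∈ range fun i ↦ ⟨i, Fin.last (n i)⟩ :=
          ⟨l'.1, (paired_tgt_eq_inr_iff.1 ht).1.symm⟩
        obtain ⟨i, hi⟩ := hmem
        obtain ⟨rfl, he⟩ := Sigma.mk.inj_iff.1 hi
        exact absurd (congrArg Fin.val (eq_of_heq he)) (Nat.one_le_iff_ne_zero.1 (hn _))
  leaf := by
    rintro ⟨i, _ | _⟩
    · refine ⟨⟨i, 0⟩, .inl rfl, ?_⟩
      rintro e (he | he)
      · exact (paired_src_eq_inr_iff.1 he).1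
      · exact nomatch (paired_tgt_eq_inr_iff.1 he).2
    · refine ⟨⟨i, Fin.last _⟩, .inr (paired_tgt_last i), ?_⟩
      rintro e (he | he)
      · exact nomatch (paired_src_eq_inr_iff.1 he).2
      · exact (paired_tgt_eq_inr_iff.1 he).1

theorem paired_exists_reachable (v : (paired n κ).I) :
    ∃ l, (paired n κ).graph.Reachable (.inl v) (.inr l) := by
  obtain ⟨⟨i, j, hj⟩⟩ := v
  refine ⟨(i, false), ?_⟩
  have hstep (j : ℕ) (hj : j < n i) := FeynmanDiagram.reachable_src_tgt (Γ := paired n κ)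
    ⟨i, (⟨j, hj⟩ : Fin (n i)).castSucc⟩
  simp only [paired_tgt_castSucc] at hstep
  induction j with
  | zero => exact (hstep 0 hj).symm
  | succ j ih => exact (hstep (j + 1) hj).symm.trans (ih (by lia))

theorem card_paired_E : Nat.card (paired n κ).E = ∑ i, n i + k := by
  change Nat.card (Σ i, Fin (n i + 1)) = _
  simp [Finset.sum_add_distrib]

theorem card_paired_L : Nat.card (paired n κ).L = 2 * k := by
  change Nat.card (Fin k × Bool) = 2 * k
  simp [mul_comm]

theorem Pairing.mk_eq_mk_iff {a b : Σ i, Fin (n i)} :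
    (Quot.mk _ a : (paired n κ).I) = Quot.mk _ b ↔ a = b ∨ a = κ.toFun b := by
  constructor
  · let orbit (a : Σ i, Fin (n i)) : Set (Σ i, Fin (n i)) := {a, κ.toFun a}
    have horbit (a b) (hab : b = κ.toFun a) : orbit a = orbit b := by
      simp only [orbit, hab, κ.involutive, pair_comm]
    intro h
    have hab : orbit a = orbit b := congrArg (Quot.lift orbit horbit) h
    exact hab.subset (mem_insert a _)
  · rintro (rfl | rfl)
    · rfl
    · exact (Quot.sound (r := fun a b ↦ b = κ.toFun a) rfl).symm

theorem two_mul_card_paired_I : 2 * Nat.card (paired n κ).I = ∑ i, n i := by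
  let mk : (Σ i, Fin (n i)) → (paired n κ).I := Quot.mk _
  have hfibre (q : (paired n κ).I) : Nat.card {a // mk a = q} = 2 := by
    obtain ⟨b, rfl⟩ := Quot.exists_rep q
    have hpair : {a | mk a = mk b} = {b, κ.toFun b} := ext fun a ↦ Pairing.mk_eq_mk_iff
    rw [← ncard_pair (κ.no_fixed b).symm, ← hpair]
    rfl
  have hcard := Nat.card_congr (Equiv.sigmaFiberEquiv mk)
  simp only [Nat.card_sigma, hfibre, Finset.sum_const, Finset.card_univ, Nat.card_fin] at hcard
  rw [← hcard, Nat.card_eq_fintype_card, smul_eq_mul, mul_comm]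

theorem card_paired_I_pos (hk : 1 ≤ k) (hn : ∀ i, 1 ≤ n i) : 0 < Nat.card (paired n κ).I :=
  Nat.card_pos_iff.2 ⟨⟨Quot.mk _ ⟨⟨0, hk⟩, 0, hn _⟩⟩, inferInstance⟩

theorem paired_valence (hn : ∀ i, 1 ≤ n i) :
    4 * Nat.card (paired n κ).I = Nat.card (paired n κ).L + 2 * (paired n κ).numIntEdges := by
  have hE := (paired_hasLegs (κ := κ) hn).card_edges
  rw [card_paired_E, card_paired_L] at hE
  have hI := two_mul_card_paired_I (κ := κ)
  rw [card_paired_L]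
  lia

end Paired

section Coupling

variable {lam ε : ℝ} {m Z : ℕ}

theorem log_one_div_pos (hε : 0 < ε) (hε1 : ε < 1) : 0 < Real.log (1 / ε) :=
  Real.log_pos ((one_lt_div hε).2 hε1)

theorem coupling_one_pos (hε : 0 < ε) (hε1 : ε < 1) : 0 < coupling 1 ε := by
  rw [coupling, one_mul]
  exact Real.rpow_pos_of_pos (log_one_div_pos hε hε1) _

theorem coupling_one_le {ε₀ : ℝ} (hε : 0 < ε) (hle : ε ≤ ε₀) (hε₀ : ε₀ < 1) :
    coupling 1 ε ≤ coupling 1 ε₀ := by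
  rw [coupling, coupling, one_mul, one_mul]
  have hε₀_pos := hε.trans_le hle
  exact Real.rpow_le_rpow_of_nonpos (log_one_div_pos hε₀_pos hε₀)
    (Real.log_le_log (one_div_pos.2 hε₀_pos) (one_div_le_one_div_of_le hε hle)) (by norm_num)

theorem tendsto_coupling_one : Filter.Tendsto (coupling 1) (𝓝[>] 0) (𝓝 0) := by
  have hlog : Filter.Tendsto (fun ε : ℝ ↦ Real.log (1 / ε)) (𝓝[>] 0) Filter.atTop := by
    simp only [one_div]
    exact Real.tendsto_log_atTop.comp tendsto_inv_nhdsGT_zero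
  refine ((tendsto_rpow_neg_atTop (one_half_pos (α := ℝ))).comp hlog).congr fun ε ↦ ?_
  rw [coupling, one_mul, Function.comp_apply]

theorem coupling_pow_mul_log_pow (hε : 0 < ε) (hε1 : ε < 1) (h : 2 * Z ≤ m) :
    |coupling lam ε| ^ m * (1 + Real.log (1 / ε)) ^ Z =
      (1 + coupling 1 ε ^ 2) ^ Z * coupling 1 ε ^ (m - 2 * Z) * |lam| ^ m := by
  have habs : |coupling lam ε| = |lam| * coupling 1 ε := by
    rw [← abs_of_pos (coupling_one_pos hε hε1), ← abs_mul, coupling, coupling, one_mul]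
  have hsq : coupling 1 ε ^ 2 * Real.log (1 / ε) = 1 := by
    have hlog := log_one_div_pos hε hε1
    rw [coupling, one_mul, ← Real.rpow_mul_natCast hlog.le,
      show (-(1 / 2) : ℝ) * (2 : ℕ) = -1 by norm_num, Real.rpow_neg_one, inv_mul_cancel₀ hlog.ne']
  have hsum : 1 + coupling 1 ε ^ 2 = coupling 1 ε ^ 2 * (1 + Real.log (1 / ε)) := by
    linear_combination -hsq
  obtain ⟨j, rfl⟩ := Nat.exists_eq_add_of_le h
  rw [habs, hsum, Nat.add_sub_cancel_left, mul_pow (coupling 1 ε ^ 2)]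
  ring

theorem coupling_pow_mul_log_pow_le {σ : ℝ} (hε : 0 < ε) (hε1 : ε < 1) (h : 2 * Z ≤ m)
    (hσ : coupling 1 ε ≤ σ) :
    |coupling lam ε| ^ m * (1 + Real.log (1 / ε)) ^ Z ≤
      (1 + σ ^ 2) ^ Z * σ ^ (m - 2 * Z) * |lam| ^ m := by
  have := (coupling_one_pos hε hε1).le
  rw [coupling_pow_mul_log_pow hε hε1 h]
  gcongr

theorem eventually_pos_and_lt_one : ∀ᶠ ε : ℝ in 𝓝[>] 0, 0 < ε ∧ ε < 1 :=
  Ioo_mem_nhdsGT one_pos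

theorem tendsto_coupling_pow_mul_log_pow (h : 2 * Z < m) :
    Filter.Tendsto (fun ε ↦ |coupling lam ε| ^ m * (1 + Real.log (1 / ε)) ^ Z)
      (𝓝[>] 0) (𝓝 0) := by
  have hcont : Continuous fun σ : ℝ ↦ (1 + σ ^ 2) ^ Z * σ ^ (m - 2 * Z) * |lam| ^ m := by fun_prop
  have hlim := (hcont.tendsto 0).comp tendsto_coupling_one
  rw [zero_pow (Nat.sub_pos_of_lt h).ne', mul_zero, zero_mul] at hlim
  refine hlim.congr' ?_
  filter_upwards [eventually_pos_and_lt_one] with ε hε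
  exact (coupling_pow_mul_log_pow hε.1 hε.2 h.le).symm

end Coupling

namespace FeynmanDiagram

variable {ρ : EuclideanSpace ℝ (Fin 4) → ℝ}

theorem exists_coupling_pow_mul_abs_valTest_le (hρ : MemLp ρ ⊤) (hsupp : HasCompactSupport ρ)
    (N d m : ℕ) {ε₀ : ℝ} (hε₀ : ε₀ < 1) :
    ∃ C : ℝ≥0, ∀ Γ : FeynmanDiagram, Γ.HasLegs →
      (∀ v, ∃ l, Γ.graph.Reachable (.inl v) (.inr l)) →
      Nat.card Γ.I = N + 1 → Nat.card Γ.L = d → Γ.numIntEdges = m →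
      (∀ γ : Γ.Subdiagram, 0 ≤ γ.degree) →
      ∀ φ : (Γ.L → Torus) → ℝ, MemLp φ ⊤ → ∀ lam ε : ℝ, 0 < ε → ε ≤ ε₀ →
        |coupling lam ε| ^ m * |Γ.valTest ρ ε φ| ≤ C * lpNorm φ ⊤ volume * |lam| ^ m := by
  obtain ⟨C, hC⟩ := exists_abs_valTest_le hρ hsupp N d m
  let σ : ℝ≥0 := (coupling 1 ε₀).toNNReal
  refine ⟨C * ((1 + σ ^ 2) ^ (m / 2) * σ ^ (m - 2 * (m / 2))),
    fun Γ hlegs hreach hI hL hm hdeg φ hφ lam ε hε hle ↦ ?_⟩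
  have hε1 := hle.trans_lt hε₀
  have hmerged (s) (hs : IsMerging s N) (i) (hi : i ≤ N) :=
    mergedCount_le_of_degree_nonneg hdeg (hs.mono hi)
  have hcount (s) (hs : IsMerging s N) :
      Nat.count (fun i ↦ mergedCount Γ.intSrc Γ.intTgt s (i + 1) = 2 * (i + 1)) N ≤ m / 2 := by
    have := two_mul_count_le (mergedCount_mono _ _ s) (hmerged s hs)
    rw [mergedCount_eq_numIntEdges hI hs, hm] at this
    lia
  have hval := hC Γ hlegs hreach hI hL hm _ hmerged hcount φ hφ ε hε hε1
  have hcoupling := coupling_pow_mul_log_pow_le (lam := lam) hε hε1 (Nat.mul_div_le m 2)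
    ((coupling_one_le hε hle hε₀).trans (Real.le_coe_toNNReal _))
  calc |coupling lam ε| ^ m * |Γ.valTest ρ ε φ|
      ≤ |coupling lam ε| ^ m *
          (C * lpNorm φ ⊤ volume * (1 + Real.log (1 / ε)) ^ (m / 2)) := by gcongr
    _ = C * lpNorm φ ⊤ volume *
          (|coupling lam ε| ^ m * (1 + Real.log (1 / ε)) ^ (m / 2)) := by ring
    _ ≤ C * lpNorm φ ⊤ volume *
          ((1 + (σ : ℝ) ^ 2) ^ (m / 2) * (σ : ℝ) ^ (m - 2 * (m / 2)) * |lam| ^ m) := by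
        have := lpNorm_nonneg (f := φ) (p := ⊤) (μ := volume)
        gcongr
    _ = _ := by push_cast; ring

variable {Γ : FeynmanDiagram} {φ : (Γ.L → Torus) → ℝ}

theorem HasLegs.tendsto_coupling_pow_mul_abs_valTest (hρ : MemLp ρ ⊤)
    (hsupp : HasCompactSupport ρ) (hlegs : Γ.HasLegs)
    (hreach : ∀ v, ∃ l, Γ.graph.Reachable (.inl v) (.inr l)) (hI : 0 < Nat.card Γ.I)
    (hc : Γ.Connected) (hdeg : ∀ γ : Γ.Subdiagram, 0 ≤ γ.degree)
    (hvalence : 4 * Nat.card Γ.I = Nat.card Γ.L + 2 * Γ.numIntEdges)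
    (hnb : Nat.card Γ.L = 4 → ¬ Γ.IsNestedBubble) (hφ : MemLp φ ⊤) (lam : ℝ) :
    Filter.Tendsto (fun ε ↦ |coupling lam ε| ^ Γ.numIntEdges * |Γ.valTest ρ ε φ|)
      (𝓝[>] 0) (𝓝 0) := by
  obtain ⟨N, hN⟩ := Nat.exists_eq_succ_of_ne_zero hI.ne'
  obtain ⟨C, hC⟩ := exists_abs_valTest_le hρ hsupp N (Nat.card Γ.L) Γ.numIntEdges
  have hcount (s) (hs : IsMerging s N) := hlegs.two_mul_count_lt hc hdeg hvalence hnb hN hs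
  have hm : 2 * ((Γ.numIntEdges - 1) / 2) < Γ.numIntEdges := by
    obtain ⟨σ, hσ, -⟩ := exists_isGreedy_strategySeq (fun _ _ : Γ.I ↦ (0 : ℝ)) hN
    have := hcount _ hσ
    lia
  have hlim := (tendsto_coupling_pow_mul_log_pow (lam := lam) hm).const_mul
    (C * lpNorm φ ⊤ volume)
  rw [mul_zero] at hlim
  refine squeeze_zero' (.of_forall fun ε ↦ by positivity) ?_ hlim
  filter_upwards [eventually_pos_and_lt_one] with ε hε
  have hval := hC Γ hlegs hreach hN rfl rfl ((Γ.numIntEdges - 1) / 2)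
    (fun s hs i hi ↦ mergedCount_le_of_degree_nonneg hdeg (hs.mono hi))
    (fun s hs ↦ by have := hcount s hs; lia) φ hφ ε hε.1 hε.2
  rw [mul_left_comm]
  gcongr

theorem IsPositive.exists_abs_valTest_le (hpos : Γ.IsPositive) (hρ : MemLp ρ ⊤)
    (hsupp : HasCompactSupport ρ) (hlegs : Γ.HasLegs)
    (hreach : ∀ v, ∃ l, Γ.graph.Reachable (.inl v) (.inr l)) (hI : 0 < Nat.card Γ.I)
    (hφ : MemLp φ ⊤) : ∃ C, ∀ ε : ℝ, 0 < ε → ε < 1 → |Γ.valTest ρ ε φ| ≤ C := by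
  obtain ⟨N, hN⟩ := Nat.exists_eq_succ_of_ne_zero hI.ne'
  obtain ⟨C, hC⟩ := FeynmanDiagram.exists_abs_valTest_le hρ hsupp N (Nat.card Γ.L) Γ.numIntEdges
  have hcount (s) (hs : IsMerging s N) :
      Nat.count (fun i ↦ mergedCount Γ.intSrc Γ.intTgt s (i + 1) = 2 * (i + 1)) N ≤ 0 := by
    refine (Nat.count_of_forall_not fun i hi ↦ ?_).le
    exact (hpos.mergedCount_lt (hs.mono hi)).ne
  refine ⟨C * lpNorm φ ⊤ volume, fun ε hε hε1 ↦ ?_⟩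
  simpa only [pow_zero, mul_one] using hC Γ hlegs hreach hN rfl rfl 0
    (fun s hs i hi ↦ mergedCount_le_of_degree_nonneg hpos.degree_nonneg (hs.mono hi))
    hcount φ hφ ε hε hε1

theorem IsPositive.tendsto_coupling_pow_mul_renValTest (hpos : Γ.IsPositive) (hρ : MemLp ρ ⊤)
    (hsupp : HasCompactSupport ρ) (hlegs : Γ.HasLegs)
    (hreach : ∀ v, ∃ l, Γ.graph.Reachable (.inl v) (.inr l)) (hI : 0 < Nat.card Γ.I)
    (hφ : MemLp φ ⊤) {p : ℕ} (hp : 0 < p) (lam : ℝ) :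
    Filter.Tendsto (fun ε ↦ coupling lam ε ^ p * Γ.renValTest ρ ε φ) (𝓝[>] 0) (𝓝 0) := by
  obtain ⟨C, hC⟩ := hpos.exists_abs_valTest_le hρ hsupp hlegs hreach hI hφ
  have hlim := (tendsto_coupling_pow_mul_log_pow (lam := lam) (Z := 0) (m := p)
    (by simpa only [mul_zero] using hp)).mul_const C
  simp only [pow_zero, mul_one, zero_mul] at hlim
  refine squeeze_zero_norm' ?_ hlim
  filter_upwards [eventually_pos_and_lt_one] with ε hε
  have hren : Γ.renValTest ρ ε φ = Γ.valTest ρ ε φ := by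
    simp only [renValTest, valTest, hpos.renVal_eq hreach]
  rw [hren, norm_mul, norm_pow, Real.norm_eq_abs, Real.norm_eq_abs]
  gcongr
  exact hC ε hε.1 hε.2

end FeynmanDiagram

section IsSmooth

variable {L : Type} [Fintype L] {φ : (L → Torus) → ℝ}

theorem IsSmooth.continuous (hφ : IsSmooth φ) : Continuous φ := by
  have hcoe : IsOpenQuotientMap ((↑) : ℝ → AddCircle (2 * Real.pi)) :=
    QuotientAddGroup.isOpenQuotientMap_mk
  have hlift : IsOpenQuotientMap
      (fun (y : L → Fin 4 → ℝ) l i ↦ (y l i : AddCircle (2 * Real.pi))) :=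
    .piMap fun _ ↦ .piMap fun _ ↦ hcoe
  exact hlift.isQuotientMap.continuous_iff.2 (ContDiff.continuous hφ)

theorem IsSmooth.memLp_top (hφ : IsSmooth φ) : MemLp φ ⊤ :=
  hφ.continuous.memLp_of_hasCompactSupport (.of_compactSpace φ)

theorem IsSmooth.lpNorm_top_le_iSup (hφ : IsSmooth φ) : lpNorm φ ⊤ volume ≤ ⨆ x, |φ x| := by
  have hbdd : BddAbove (range fun x ↦ |φ x|) :=
    (isCompact_range hφ.continuous.abs).bddAbove
  have hle (x) : ‖φ x‖ ≤ ⨆ x, |φ x| := le_ciSup hbdd x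
  rw [← toReal_eLpNorm hφ.memLp_top.1]
  exact ENNReal.toReal_le_of_le_ofReal ((norm_nonneg _).trans (hle 0))
    (eLpNormEssSup_le_of_ae_bound (.of_forall hle))

end IsSmooth

theorem lemma4_general {ρ : EuclideanSpace ℝ (Fin 4) → ℝ} (hρ : MemLp ρ ⊤)
    (hsupp : HasCompactSupport ρ) {k : ℕ} (hk : 1 ≤ k) :
    (∀ (m : ℕ) (ε₀ : ℝ), ε₀ < 1 → ∃ C : ℝ≥0,
      ∀ (n : Fin k → ℕ) (κ : Pairing n), (∀ i, 1 ≤ n i) →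
        (∀ γ : (paired n κ).Subdiagram, 0 ≤ γ.degree) → (paired n κ).numIntEdges = m →
        ∀ φ : (Fin k × Bool → Torus) → ℝ, MemLp φ ⊤ → ∀ lam ε : ℝ, 0 < ε → ε ≤ ε₀ →
          |coupling lam ε| ^ m * |(paired n κ).valTest ρ ε φ| ≤
            C * lpNorm φ ⊤ volume * |lam| ^ m) ∧
    (∀ (n : Fin k → ℕ) (κ : Pairing n), (∀ i, 1 ≤ n i) → (paired n κ).Connected →
        (∀ γ : (paired n κ).Subdiagram, 0 ≤ γ.degree) →
        (k ≠ 2 ∨ ¬ (paired n κ).IsNestedBubble) →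
        ∀ φ : (Fin k × Bool → Torus) → ℝ, MemLp φ ⊤ → ∀ lam : ℝ,
          Filter.Tendsto (fun ε ↦ |coupling lam ε| ^ (paired n κ).numIntEdges *
            |(paired n κ).valTest ρ ε φ|) (𝓝[>] 0) (𝓝 0)) ∧
    (∀ (n : Fin k → ℕ) (κ : Pairing n), (∀ i, 1 ≤ n i) → (paired n κ).IsPositive →
        (∀ ε x, (paired n κ).renVal ρ ε x = (paired n κ).val ρ ε x) ∧
        ∀ φ : (Fin k × Bool → Torus) → ℝ, MemLp φ ⊤ →
          (∃ C : ℝ, ∀ ε : ℝ, 0 < ε → ε < 1 → |(paired n κ).valTest ρ ε φ| ≤ C) ∧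
          ((∃ i, 2 ≤ n i) → ∀ lam : ℝ,
            Filter.Tendsto (fun ε ↦ coupling lam ε ^ (∑ i, (n i - 1)) *
              (paired n κ).renValTest ρ ε φ) (𝓝[>] 0) (𝓝 0))) := by
  refine ⟨fun m ε₀ hε₀ ↦ ?_, fun n κ hn hc hdeg hnb φ hφ lam ↦ ?_,
    fun n κ hn hpos ↦ ⟨fun ε ↦ hpos.renVal_eq paired_exists_reachable, fun φ hφ ↦
      ⟨hpos.exists_abs_valTest_le hρ hsupp (paired_hasLegs hn) paired_exists_reachable
        (card_paired_I_pos hk hn) hφ, fun ⟨i, hi⟩ lam ↦ ?_⟩⟩⟩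
  · obtain ⟨C, hC⟩ := FeynmanDiagram.exists_coupling_pow_mul_abs_valTest_le hρ hsupp
      ((k + m) / 2 - 1) (2 * k) m hε₀
    refine ⟨C, fun n κ hn hdeg hm ↦ hC _ (paired_hasLegs hn) paired_exists_reachable ?_
      card_paired_L hm hdeg⟩
    have hvalence := paired_valence (κ := κ) hn
    rw [card_paired_L, hm] at hvalence
    have := card_paired_I_pos (κ := κ) hk hn
    lia
  · refine (paired_hasLegs hn).tendsto_coupling_pow_mul_abs_valTest hρ hsupp
      paired_exists_reachable (card_paired_I_pos hk hn) hc hdeg (paired_valence hn)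
      (fun hL ↦ hnb.resolve_left (not_not.2 ?_)) hφ lam
    rw [card_paired_L] at hL
    lia
  · refine hpos.tendsto_coupling_pow_mul_renValTest hρ hsupp (paired_hasLegs hn)
      paired_exists_reachable (card_paired_I_pos hk hn) hφ ?_ lam
    exact Finset.sum_pos' (fun _ _ ↦ Nat.zero_le _) ⟨i, Finset.mem_univ i, Nat.sub_pos_of_lt hi⟩

end AndersonFeynman

open AndersonFeynman in
theorem lemma4 (ρ : EuclideanSpace ℝ (Fin 4) → ℝ) (hρ : IsMollifier ρ) (k : ℕ) (hk : 1 ≤ k) :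
    -- uniform bound for connected positive or zero degree diagrams
    (∀ (m : ℕ) (ε₀ : ℝ), 0 < ε₀ → ε₀ < 1 → ∃ C : ℝ,
      ∀ (n : Fin k → ℕ) (κ : Pairing n), (∀ i, 1 ≤ n i) →
        (paired n κ).Connected → ((paired n κ).IsPositive ∨ (paired n κ).IsZeroDegree) →
        (paired n κ).numIntEdges = m →
        ∀ φ : (Fin k × Bool → Torus) → ℝ, IsSmooth φ →
        ∀ lam : ℝ, ∀ ε : ℝ, 0 < ε → ε ≤ ε₀ →
          |coupling lam ε| ^ m * |(paired n κ).valTest ρ ε φ| ≤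
            C * (⨆ x, |φ x|) * |lam| ^ m) ∧
    -- only nested bubble diagrams with four legs can survive in the limit
    (∀ (n : Fin k → ℕ) (κ : Pairing n), (∀ i, 1 ≤ n i) →
        (paired n κ).Connected → ((paired n κ).IsPositive ∨ (paired n κ).IsZeroDegree) →
        (k ≠ 2 ∨ ¬ (paired n κ).IsNestedBubble) →
        ∀ φ : (Fin k × Bool → Torus) → ℝ, IsSmooth φ → ∀ lam : ℝ,
          Filter.Tendsto
            (fun ε : ℝ => |coupling lam ε| ^ (paired n κ).numIntEdges *
              |(paired n κ).valTest ρ ε φ|)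
            (𝓝[>] 0) (𝓝 0)) ∧
    -- positive diagrams, connected or not, need no renormalisation and do not contribute
    (∀ (n : Fin k → ℕ) (κ : Pairing n), (∀ i, 1 ≤ n i) → (paired n κ).IsPositive →
        (∀ ε : ℝ, 0 < ε → ε < 1 → ∀ x : Fin k × Bool → Torus,
          (paired n κ).renVal ρ ε x = (paired n κ).val ρ ε x) ∧
        ∀ φ : (Fin k × Bool → Torus) → ℝ, IsSmooth φ →
          (∃ C : ℝ, ∀ ε : ℝ, 0 < ε → ε < 1 → |(paired n κ).valTest ρ ε φ| ≤ C) ∧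
          ((∃ i, 2 ≤ n i) → ∀ lam : ℝ,
            Filter.Tendsto
              (fun ε : ℝ => coupling lam ε ^ (∑ i, (n i - 1)) *
                (paired n κ).renValTest ρ ε φ)
              (𝓝[>] 0) (𝓝 0))) := by
  obtain ⟨hbound, hlim, hpositive⟩ := lemma4_general
    (hρ.smooth.continuous.memLp_of_hasCompactSupport hρ.compact_support) hρ.compact_support hk
  have hdegree {n : Fin k → ℕ} {κ : Pairing n} :
      (paired n κ).IsPositive ∨ (paired n κ).IsZeroDegree →
        ∀ γ : (paired n κ).Subdiagram, 0 ≤ γ.degree :=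
    Or.rec FeynmanDiagram.IsPositive.degree_nonneg And.left
  refine ⟨fun m ε₀ _ hε₀ ↦ ?_,
    fun n κ hn hc hdeg hnb φ hφ ↦ hlim n κ hn hc (hdegree hdeg) hnb φ hφ.memLp_top,
    fun n κ hn hpos ↦ ⟨fun ε _ _ ↦ (hpositive n κ hn hpos).1 ε,
      fun φ hφ ↦ (hpositive n κ hn hpos).2 φ hφ.memLp_top⟩⟩
  obtain ⟨C, hC⟩ := hbound m ε₀ hε₀
  refine ⟨C, fun n κ hn _ hdeg hm φ hφ lam ε hε hle ↦ ?_⟩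
  grw [hC n κ hn (hdegree hdeg) hm φ hφ.memLp_top lam ε hε hle, hφ.lpNorm_top_le_iSup]
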